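/- Let $s_1,\dots,s_n$ be $n$ distinct points (sites) in $\mathbb{R}^2$ with appetites $A_1,\dots,A_n>0$. The stable-matching Voronoi diagram of these data is the subdivision of $\mathbb{R}^2$ into closed regions $C_1,\dots,C_n$ and $C_\emptyset$ (the unmatched points), each of which is the closure of its interior, such that the regions cover the plane and overlap only along their boundaries, $C_i$ has area $A_i$ for every $i$, and there is no blocking pair. Here a site $s_i$ and a point $p\in\mathbb{R}^2$ form a blocking pair if $p\notin C_i$, $d(p,s_i)<\max\{d(q,s_i): q\in C_i\}$, and either $p\in C_\emptyset$ or $d(p,s_i)<d(p,s_j)$ for some $j$ with $p\in C_j$. The faces of the diagram are the connected components of the regions; those of $C_\emptyset$ are called empty faces. An edge is a maximal (nondegenerate) line segment or circular arc on the common boundary of two faces, where, if two such circular arcs touch at a point that is not an endpoint, they are split there. A vertex is a point shared by more than one edge. **Theorem.** In the worst case, a stable-matching Voronoi diagram of $n$ point sites has $\Omega(n^2)$ faces, edges, and vertices, even when all sites have the same appetite. That is, there are a constant $c>0$ and an integer $N$ such that for every $n\ge N$ and every $a>0$ there are $n$ distinct sites in $\mathbb{R}^2$ whose stable-matching Voronoi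 diagram, with all appetites equal to $a$, has at least $cn^2$ faces (even without counting the empty faces), at least $cn^2$ edges, and at least $cn^2$ vertices. -/

import Mathlib

open scoped ENNReal

/-- The Euclidean plane. -/
abbrev Plane : Type := EuclideanSpace ℝ (Fin 2)

/-- `(s i, p)` is a blocking pair for the assignment `C` of regions: `p` is not in the region of
`s i`, the site `s i` is closer to `p` than to some point of its own region (i.e. `dist p (s i)` is
less than the maximal distance from `s i` to its region), and `p` is unmatched or is matched to a
site that is farther away from `p` than `s i`. -/
def IsBlockingPair {ι : Type*} (s : ι → Plane) (C : Option ι → Set Plane) (i : ι) (p : Plane) :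
    Prop :=
  p ∉ C (some i) ∧
  (∃ q ∈ C (some i), dist p (s i) < dist q (s i)) ∧
  (p ∈ C none ∨ ∃ j, p ∈ C (some j) ∧ dist p (s i) < dist p (s j))

/-- `C` is the stable-matching Voronoi diagram of the sites `s` with appetites `A`.
`C (some i)` is the region (stable cell) of the site `s i`, and `C none` is the region of the
unmatched points. The regions are closed sets; they are the closures of their interiors, so that no
region carries stray isolated points or curves (of area zero). -/
structure IsStableMatchingVoronoi {ι : Type*} (s : ι → Plane) (A : ι → ℝ)
    (C : Option ι → Set Plane) : Prop where
  cover : ⋃ o, C o = Set.univ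
  closure_interior : ∀ o, closure (interior (C o)) = C o
  inter_subset_frontier : ∀ o o', o ≠ o' → C o ∩ C o' ⊆ frontier (C o) ∩ frontier (C o')
  area : ∀ i, MeasureTheory.volume (C (some i)) = ENNReal.ofReal (A i)
  stable : ∀ i p, ¬ IsBlockingPair s C i p

/-- The connected components of a set: its maximal connected (nonempty) subsets. -/
def componentsOf (R : Set Plane) : Set (Set Plane) :=
  {F | ∃ x ∈ R, F = connectedComponentIn R x}

/-- The faces of the stable cells of the sites (the empty faces are not included). -/
def cellFaces {ι : Type*} (C : Option ι → Set Plane) : Set (Set Plane) :=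
  {F | ∃ i, F ∈ componentsOf (C (some i))}

/-- All the faces of the diagram: the faces of the stable cells and the empty faces. -/
def faces {ι : Type*} (C : Option ι → Set Plane) : Set (Set Plane) :=
  {F | ∃ o, F ∈ componentsOf (C o)}

/-- Nondegenerate line segments. -/
def IsSegment (E : Set Plane) : Prop :=
  ∃ a b : Plane, a ≠ b ∧ E = segment ℝ a b

/-- The point with angle `θ` on the circle with center `z` and radius `r`. -/
noncomputable def circlePoint (z : Plane) (r θ : ℝ) : Plane :=
  !₂[z 0 + r * Real.cos θ, z 1 + r * Real.sin θ]

/-- `E` is a nondegenerate circular arc (possibly a full circle), and `I` is obtained from it by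
deleting its two endpoints. A full circle has no distinguished endpoints; for it, `I` is the circle
with any one of its points deleted. -/
def IsArcWithInterior (E I : Set Plane) : Prop :=
  ∃ (z : Plane) (r α β : ℝ), 0 < r ∧ α < β ∧ β ≤ α + 2 * Real.pi ∧
    E = circlePoint z r '' Set.Icc α β ∧ I = circlePoint z r '' Set.Ioo α β

/-- The maximal circular arcs on the boundary of two faces. (Distinct faces of a diagram meet only
along their boundaries, so `F ∩ F'` is the common boundary of `F` and `F'`.) -/
def maximalArcs {ι : Type*} (C : Option ι → Set Plane) : Set (Set Plane) :=
  {E | ∃ F ∈ faces C, ∃ F' ∈ faces C, F ≠ F' ∧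
    Maximal (fun E => (∃ I, IsArcWithInterior E I) ∧ E ⊆ F ∩ F') E}

/-- The points where two maximal circular arcs touch that are not endpoints of these arcs.
(There are none if the sites are in general position.) -/
def tangencyPoints {ι : Type*} (C : Option ι → Set Plane) : Set Plane :=
  {p | ∃ E₁ ∈ maximalArcs C, ∃ E₂ ∈ maximalArcs C, E₁ ≠ E₂ ∧
    (∃ I, IsArcWithInterior E₁ I ∧ p ∈ I) ∧ (∃ I, IsArcWithInterior E₂ I ∧ p ∈ I)}

/-- The straight edges: the maximal line segments on the boundary of two faces. -/
def straightEdges {ι : Type*} (C : Option ι → Set Plane) : Set (Set Plane) :=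
  {E | ∃ F ∈ faces C, ∃ F' ∈ faces C, F ≠ F' ∧ Maximal (fun E => IsSegment E ∧ E ⊆ F ∩ F') E}

/-- The curved edges: the maximal circular arcs on the boundary of two faces, where arcs are split
at points of tangency. -/
def curvedEdges {ι : Type*} (C : Option ι → Set Plane) : Set (Set Plane) :=
  {E | ∃ F ∈ faces C, ∃ F' ∈ faces C, F ≠ F' ∧
    Maximal (fun E => (∃ I, IsArcWithInterior E I ∧ Disjoint I (tangencyPoints C)) ∧
      E ⊆ F ∩ F') E}

/-- The edges of the diagram. -/
def edges {ι : Type*} (C : Option ι → Set Plane) : Set (Set Plane) :=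
  straightEdges C ∪ curvedEdges C

/-- The vertices of the diagram: the points shared by more than one edge. -/
def vertices {ι : Type*} (C : Option ι → Set Plane) : Set Plane :=
  {v | ∃ E₁ ∈ edges C, ∃ E₂ ∈ edges C, E₁ ≠ E₂ ∧ v ∈ E₁ ∧ v ∈ E₂}

/-! ### Distances in coordinates -/

open MeasureTheory Set Filter Topology Metric

/-! Every choice of radii gives a stable diagram: a point goes to the nearest of the sites within
whose radius it lies. The task is to choose sites so that equal cell areas force quadratically many
pieces.

A column of sites is placed on the vertical axis at spacing `t`. Its inner sites all have radius
`r`, and `t` is chosen so that the part of a disc of radius `r` in a strip of width `t` has area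
`a`. Consecutive discs cross at abscissa `√(r² - (t/2)²) < r`; to the right of the crossing they
leave an unclaimed notch. Far above the column stands a row of sites at spacing `ε`, with all
abscissas between that of the crossing and `r`. Among themselves, the row sites split the plane into
vertical strips. If a middle row site reaches past the notches, its strip runs down through each of
them, and the column discs cut it into pieces. Each pair of a middle strip and a central notch thus
yields a separate face, bounded by vertical segments and circular arcs. A positive fraction of the
sites are middle row sites, and linearly many notches are central, so the count is quadratic.

Stable radii exist for any finite measure budget: maximize the sum of the radii subject to no cell
exceeding its appetite (`exists_radii`). The column is solved first, and then the row for Lebesgue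
measure outside the column discs; the two solutions combine because a column site is closer than any
row site to each point within its radius (`exists_radii_glue`).

The radii are controlled by a crowding argument. If a site with many sites on one side had a small
radius, its cell would be too large in area to stay near the row (or the column end), so it would
own a point to which all those sites are closer. They do not take that point, so their radii are
small too, and their cells lie in one disc too small for their total area (`le_radius_of_row`,
`le_radius_of_end`). A minimality argument with disc strips then gives radius exactly `r` inside the
column (`radius_eq_of_column`). -/

theorem Plane.dist_sq (p q : Plane) : dist p q ^ 2 = (p 0 - q 0) ^ 2 + (p 1 - q 1) ^ 2 := by
  rw [EuclideanSpace.dist_eq, Real.sq_sqrt (by positivity), Fin.sum_univ_two, Real.dist_eq,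
    Real.dist_eq, sq_abs, sq_abs]

theorem Plane.dist_lt_dist_iff {p q p' q' : Plane} : dist p q < dist p' q' ↔
    (p 0 - q 0) ^ 2 + (p 1 - q 1) ^ 2 < (p' 0 - q' 0) ^ 2 + (p' 1 - q' 1) ^ 2 := by
  rw [← Plane.dist_sq, ← Plane.dist_sq, sq_lt_sq₀ dist_nonneg dist_nonneg]

theorem Plane.dist_lt_iff {p q : Plane} {d : ℝ} (hd : 0 ≤ d) : dist p q < d ↔
    (p 0 - q 0) ^ 2 + (p 1 - q 1) ^ 2 < d ^ 2 := by
  rw [← Plane.dist_sq, sq_lt_sq₀ dist_nonneg hd]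

theorem Plane.lt_dist_iff {p q : Plane} {d : ℝ} (hd : 0 ≤ d) : d < dist p q ↔
    d ^ 2 < (p 0 - q 0) ^ 2 + (p 1 - q 1) ^ 2 := by
  rw [← Plane.dist_sq, sq_lt_sq₀ hd dist_nonneg]

theorem Plane.dist_le_iff {p q : Plane} {d : ℝ} (hd : 0 ≤ d) : dist p q ≤ d ↔
    (p 0 - q 0) ^ 2 + (p 1 - q 1) ^ 2 ≤ d ^ 2 := by
  rw [← not_lt, Plane.lt_dist_iff hd, not_lt]

/-! ### Diagrams defined by radii, and their stability -/

section Cells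

variable {ι : Type*}

/-- The points within distance less than `ρ i` of the site `s i` that are closer to `s i` than to
any other site `s j` with the point within distance `ρ j`. -/
def cellCore (s : ι → Plane) (ρ : ι → ℝ) (i : ι) : Set Plane :=
  {p | dist p (s i) < ρ i ∧ ∀ j, j ≠ i → ρ j < dist p (s j) ∨ dist p (s i) < dist p (s j)}

/-- The points that are out of the reach of all the sites. -/
def outerCore (s : ι → Plane) (ρ : ι → ℝ) : Set Plane :=
  {p | ∀ j, ρ j < dist p (s j)}

/-- The diagram in which the site `s i` is matched up to the radius `ρ i`. -/
def radiiDiagram (s : ι → Plane) (ρ : ι → ℝ) : Option ι → Set Plane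
  | none => closure (outerCore s ρ)
  | some i => closure (cellCore s ρ i)

/-- The circles and the bisectors that contain all the boundaries of the cells. -/
def wallSet (s : ι → Plane) (ρ : ι → ℝ) : Set Plane :=
  (⋃ i, sphere (s i) (ρ i)) ∪ ⋃ i, ⋃ j, ⋃ (_ : i ≠ j), {p | dist p (s i) = dist p (s j)}

/-- A competitor at least as close as the owner can only have lost the point by not reaching it.
This is the source of the bounds on radii in the crowding arguments. -/
theorem mem_cellCore_of_subset {s : ι → Plane} {ρ : ι → ℝ} {i : ι} {p : Plane}
    (h : p ∈ cellCore s ρ i) {j : ι} (hj : j ≠ i) (hd : dist p (s j) ≤ dist p (s i)) :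
    ρ j < dist p (s j) :=
  (h.2 j hj).resolve_right (not_lt.2 hd)

theorem cellCore_subset_ball (s : ι → Plane) (ρ : ι → ℝ) (i : ι) :
    cellCore s ρ i ⊆ ball (s i) (ρ i) := fun _ h => h.1

theorem disjoint_cellCore (s : ι → Plane) (ρ : ι → ℝ) {i j : ι} (hij : i ≠ j) :
    Disjoint (cellCore s ρ i) (cellCore s ρ j) := by
  rw [Set.disjoint_left]
  rintro p ⟨h1, h2⟩ ⟨h3, h4⟩
  rcases h2 j hij.symm with h | h
  · exact lt_asymm h h3
  · rcases h4 i hij with h' | h'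
    · exact lt_asymm h' h1
    · exact lt_asymm h h'

theorem disjoint_cellCore_outerCore (s : ι → Plane) (ρ : ι → ℝ) (i : ι) :
    Disjoint (cellCore s ρ i) (outerCore s ρ) := by
  rw [Set.disjoint_left]
  rintro p ⟨h1, _⟩ h
  exact lt_asymm h1 (h i)

theorem isOpen_cellCore [Finite ι] (s : ι → Plane) (ρ : ι → ℝ) (i : ι) :
    IsOpen (cellCore s ρ i) := by
  have : cellCore s ρ i = {p | dist p (s i) < ρ i} ∩ ⋂ j, ⋂ (_ : j ≠ i),
      ({p | ρ j < dist p (s j)} ∪ {p | dist p (s i) < dist p (s j)}) := by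
    ext p; simp [cellCore]
  rw [this]
  refine IsOpen.inter (isOpen_lt (by fun_prop) (by fun_prop)) ?_
  refine isOpen_iInter_of_finite fun j => isOpen_iInter_of_finite fun _ => IsOpen.union ?_ ?_
  · exact isOpen_lt (by fun_prop) (by fun_prop)
  · exact isOpen_lt (by fun_prop) (by fun_prop)

theorem isOpen_outerCore [Finite ι] (s : ι → Plane) (ρ : ι → ℝ) : IsOpen (outerCore s ρ) := by
  have : outerCore s ρ = ⋂ j, {p | ρ j < dist p (s j)} := by ext p; simp [outerCore]
  rw [this]
  exact isOpen_iInter_of_finite fun j => isOpen_lt (by fun_prop) (by fun_prop)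

theorem volume_setOf_dist_eq {a b : Plane} (h : a ≠ b) :
    volume {p : Plane | dist p a = dist p b} = 0 := by
  have h1 : {p : Plane | dist p a = dist p b} = (AffineSubspace.perpBisector a b : Set Plane) := by
    ext p; simp [AffineSubspace.mem_perpBisector_iff_dist_eq]
  rw [h1]
  refine Measure.addHaar_affineSubspace _ _ fun htop => h ?_
  have : a ∈ AffineSubspace.perpBisector a b := by rw [htop]; trivial
  simpa using this

theorem volume_wallSet [Finite ι] {s : ι → Plane} (hs : Function.Injective s) (ρ : ι → ℝ) :
    volume (wallSet s ρ) = 0 := by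
  refine measure_union_null (measure_iUnion_null fun i => Measure.addHaar_sphere _ _ _) ?_
  exact measure_iUnion_null fun i => measure_iUnion_null fun j => measure_iUnion_null fun h =>
    volume_setOf_dist_eq (hs.ne h)

theorem dense_compl_wallSet [Finite ι] {s : ι → Plane} (hs : Function.Injective s) (ρ : ι → ℝ) :
    Dense (wallSet s ρ)ᶜ := by
  rw [← interior_eq_empty_iff_dense_compl]
  exact Measure.interior_eq_empty_of_null (volume_wallSet hs ρ)

theorem exists_mem_cellCore [Finite ι] {s : ι → Plane} {ρ : ι → ℝ} {p : Plane}
    (hp : p ∉ wallSet s ρ) {j : ι} (hj : dist p (s j) < ρ j) : ∃ i, p ∈ cellCore s ρ i := by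
  have hp1 : ∀ i, dist p (s i) ≠ ρ i := fun i h => hp (Or.inl (mem_iUnion.2 ⟨i, h⟩))
  have hp2 : ∀ i j, i ≠ j → dist p (s i) ≠ dist p (s j) := fun i j h h' =>
    hp (Or.inr (by simp only [mem_iUnion]; exact ⟨i, j, h, h'⟩))
  obtain ⟨i, hi, hmin⟩ := Set.exists_min_image {i | dist p (s i) < ρ i} (fun i => dist p (s i))
    (Set.toFinite _) ⟨j, hj⟩
  refine ⟨i, hi, fun k hk => ?_⟩
  rcases lt_or_ge (ρ k) (dist p (s k)) with h | h
  · exact Or.inl h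
  · exact Or.inr (lt_of_le_of_ne (hmin k (lt_of_le_of_ne h (hp1 k))) (hp2 i k hk.symm))

theorem exists_mem_core [Finite ι] {s : ι → Plane} {ρ : ι → ℝ} {p : Plane}
    (hp : p ∉ wallSet s ρ) : p ∈ outerCore s ρ ∨ ∃ i, p ∈ cellCore s ρ i := by
  by_cases h : ∃ j, dist p (s j) < ρ j
  · obtain ⟨j, hj⟩ := h
    exact Or.inr (exists_mem_cellCore hp hj)
  · push Not at h
    refine Or.inl fun j => lt_of_le_of_ne (h j) fun h' => hp (Or.inl (mem_iUnion.2 ⟨j, h'.symm⟩))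

theorem dist_le_of_mem_radiiDiagram {s : ι → Plane} {ρ : ι → ℝ} {i : ι} {p : Plane}
    (hp : p ∈ radiiDiagram s ρ (some i)) : dist p (s i) ≤ ρ i := by
  have : closure (cellCore s ρ i) ⊆ {p | dist p (s i) ≤ ρ i} :=
    closure_minimal (fun p h => h.1.le) (isClosed_le (by fun_prop) (by fun_prop))
  exact this hp

theorem dist_le_dist_of_mem_radiiDiagram {s : ι → Plane} {ρ : ι → ℝ} {i j : ι} {p : Plane}
    (hp : p ∈ radiiDiagram s ρ (some i)) (hj : dist p (s j) < ρ j) :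
    dist p (s i) ≤ dist p (s j) := by
  by_cases hij : j = i
  · rw [hij]
  have : closure (cellCore s ρ i) ⊆ {p | ρ j ≤ dist p (s j)} ∪ {p | dist p (s i) ≤ dist p (s j)} :=
    closure_minimal (fun p h => (h.2 j hij).imp le_of_lt le_of_lt)
      ((isClosed_le (by fun_prop) (by fun_prop)).union (isClosed_le (by fun_prop) (by fun_prop)))
  exact (this hp).resolve_left (not_le.2 hj)

theorem le_dist_of_mem_radiiDiagram_none {s : ι → Plane} {ρ : ι → ℝ} (i : ι) {p : Plane}
    (hp : p ∈ radiiDiagram s ρ none) : ρ i ≤ dist p (s i) := by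
  have : closure (outerCore s ρ) ⊆ {p | ρ i ≤ dist p (s i)} :=
    closure_minimal (fun p h => (h i).le) (isClosed_le (by fun_prop) (by fun_prop))
  exact this hp

theorem closure_inter_subset_frontier {X : Type*} [TopologicalSpace X] {U V : Set X}
    (hU : IsOpen U) (hV : IsOpen V) (h : Disjoint U V) :
    closure U ∩ closure V ⊆ frontier (closure U) ∩ frontier (closure V) := by
  have key : ∀ {U V : Set X}, IsOpen U → IsOpen V → Disjoint U V → ∀ p, p ∈ closure U →
      p ∈ closure V → p ∈ frontier (closure U) := by
    intro U V hU hV h p hpU hpV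
    rw [isClosed_closure.frontier_eq]
    refine ⟨hpU, fun hi => ?_⟩
    obtain ⟨q, hq1, hq2⟩ := mem_closure_iff.1 hpV _ isOpen_interior hi
    obtain ⟨q', h1, h2⟩ := mem_closure_iff.1 (interior_subset hq1) _ hV hq2
    exact Set.disjoint_left.1 h h2 h1
  exact fun p hp => ⟨key hU hV h p hp.1 hp.2, key hV hU h.symm p hp.2 hp.1⟩

/-- Off the circles and bisectors, every point lies in one of the pairwise disjoint open cores, so
it is no boundary point. Hence the frontiers are null, and passing to closures leaves areas
unchanged. -/
theorem frontier_cellCore_subset [Finite ι] (s : ι → Plane) (ρ : ι → ℝ) (i : ι) :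
    frontier (cellCore s ρ i) ⊆ wallSet s ρ := by
  intro p hp
  by_contra hw
  rw [(isOpen_cellCore s ρ i).frontier_eq] at hp
  rcases exists_mem_core hw with h | ⟨j, h⟩
  · obtain ⟨q, h1, h2⟩ := mem_closure_iff.1 hp.1 _ (isOpen_outerCore s ρ) h
    exact Set.disjoint_left.1 (disjoint_cellCore_outerCore s ρ i) h2 h1
  · rcases eq_or_ne i j with rfl | hij
    · exact hp.2 h
    · obtain ⟨q, h1, h2⟩ := mem_closure_iff.1 hp.1 _ (isOpen_cellCore s ρ j) h
      exact Set.disjoint_left.1 (disjoint_cellCore s ρ hij) h2 h1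

/-- Stability is automatic: a site in a blocking pair would have the point strictly within its
radius, and such a point is never unmatched nor matched to a farther site. Only the areas need a
hypothesis. -/
theorem isStableMatchingVoronoi_radiiDiagram [Finite ι] {s : ι → Plane}
    (hs : Function.Injective s) {ρ : ι → ℝ} {a : ℝ}
    (ha : ∀ i, volume (cellCore s ρ i) = ENNReal.ofReal a) :
    IsStableMatchingVoronoi s (fun _ => a) (radiiDiagram s ρ) := by
  have hcl : ∀ U : Set Plane, IsOpen U → closure (interior (closure U)) = closure U := by
    intro U hU
    refine (closure_minimal interior_subset isClosed_closure).antisymm (closure_mono ?_)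
    exact interior_maximal subset_closure hU
  refine ⟨?_, ?_, ?_, ?_, ?_⟩
  · have hclosed : IsClosed (⋃ o, radiiDiagram s ρ o) := by
      refine isClosed_iUnion_of_finite fun o => ?_
      cases o <;> exact isClosed_closure
    rw [← hclosed.closure_eq, ← dense_iff_closure_eq]
    refine (dense_compl_wallSet hs ρ).mono fun p hp => ?_
    rcases exists_mem_core hp with h | ⟨i, h⟩
    · exact mem_iUnion.2 ⟨none, subset_closure h⟩
    · exact mem_iUnion.2 ⟨some i, subset_closure h⟩
  · rintro (_ | i)
    · exact hcl _ (isOpen_outerCore s ρ)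
    · exact hcl _ (isOpen_cellCore s ρ i)
  · rintro (_ | i) (_ | j) hij
    · exact absurd rfl hij
    · exact closure_inter_subset_frontier (isOpen_outerCore s ρ) (isOpen_cellCore s ρ j)
        (disjoint_cellCore_outerCore s ρ j).symm
    · exact closure_inter_subset_frontier (isOpen_cellCore s ρ i) (isOpen_outerCore s ρ)
        (disjoint_cellCore_outerCore s ρ i)
    · exact closure_inter_subset_frontier (isOpen_cellCore s ρ i) (isOpen_cellCore s ρ j)
        (disjoint_cellCore s ρ (fun h => hij (by rw [h])))
  · intro i
    rw [← ha i]
    refine measure_congr (closure_ae_eq_of_null_frontier ?_)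
    exact measure_mono_null (frontier_cellCore_subset s ρ i) (volume_wallSet hs ρ)
  · rintro i p ⟨_, ⟨q, hq, hpq⟩, h⟩
    have hpi : dist p (s i) < ρ i := hpq.trans_le (dist_le_of_mem_radiiDiagram hq)
    rcases h with h | ⟨j, h, hij⟩
    · exact (le_dist_of_mem_radiiDiagram_none i h).not_gt hpi
    · exact (dist_le_dist_of_mem_radiiDiagram h hpi).not_gt hij

/-- Enlarging one radius enlarges that cell and shrinks all the others; the maximality argument for
stable radii rests on this monotonicity. -/
theorem cellCore_mono {s : ι → Plane} {ρ ρ' : ι → ℝ} {i : ι} (hi : ρ i ≤ ρ' i)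
    (h : ∀ j, j ≠ i → ρ' j ≤ ρ j) : cellCore s ρ i ⊆ cellCore s ρ' i := fun _ hp =>
  ⟨hp.1.trans_le hi, fun j hj => (hp.2 j hj).imp_left (h j hj).trans_lt⟩

/-! ### Existence of stable radii, and area bounds -/

section Existence

variable {μ : Measure Plane}

/-- At a point off the null walls, membership is locally constant in the radii; dominated
convergence does the rest. -/
theorem tendsto_measure_cellCore [Finite ι] {s : ι → Plane} (hs : Function.Injective s)
    (hμ : μ ≤ volume) (ρ : ι → ℝ) (i : ι) :
    Tendsto (fun ρ' => μ (cellCore s ρ' i)) (𝓝 ρ) (𝓝 (μ (cellCore s ρ i))) := by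
  have := Fintype.ofFinite ι
  refine tendsto_measure_of_ae_tendsto_indicator (B := ball (s i) (ρ i + 1)) _
    (isOpen_cellCore s ρ i).measurableSet (fun ρ' => (isOpen_cellCore s ρ' i).measurableSet)
    measurableSet_ball ((hμ _).trans_lt measure_ball_lt_top).ne ?_ ?_
  · have : ∀ᶠ ρ' : ι → ℝ in 𝓝 ρ, ρ' i < ρ i + 1 :=
      (continuous_apply i).continuousAt.eventually_lt continuousAt_const (by simp)
    filter_upwards [this] with ρ' h
    exact (cellCore_subset_ball s ρ' i).trans (ball_subset_ball h.le)
  · have h0 : μ (wallSet s ρ) = 0 := le_antisymm ((hμ _).trans (volume_wallSet hs ρ).le) zero_le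
    filter_upwards [compl_mem_ae_iff.2 h0] with p hp
    have hp1 : ∀ j, dist p (s j) ≠ ρ j := fun i h => hp (Or.inl (mem_iUnion.2 ⟨i, h⟩))
    have hj : ∀ j, ∀ᶠ ρ' : ι → ℝ in 𝓝 ρ,
        (dist p (s j) < ρ' j ↔ dist p (s j) < ρ j) ∧ (ρ' j < dist p (s j) ↔ ρ j < dist p (s j)) := by
      intro j
      have hc : ContinuousAt (fun ρ' : ι → ℝ => ρ' j) ρ := (continuous_apply j).continuousAt
      rcases lt_or_gt_of_ne (hp1 j) with h | h
      · filter_upwards [continuousAt_const.eventually_lt hc h] with ρ' h'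
        exact ⟨iff_of_true h' h, iff_of_false h'.not_gt h.not_gt⟩
      · filter_upwards [hc.eventually_lt continuousAt_const h] with ρ' h'
        exact ⟨iff_of_false h'.not_gt h.not_gt, iff_of_true h' h⟩
    filter_upwards [eventually_all.2 hj] with ρ' h
    simp only [cellCore, mem_ofPred_eq, h]

/-- A compactness argument: take radii of maximal sum among those for which no cell exceeds `a`. A
cell with too little area could grow a bit more, at the expense of the others only. A general
measure is allowed so that the row can be solved in the space left over by the column. -/
theorem exists_radii [Finite ι] {s : ι → Plane} (hs : Function.Injective s)
    (hμ : μ ≤ volume) (huniv : μ univ = ∞) (a : ℝ) :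
    ∃ ρ : ι → ℝ, ∀ i, μ (cellCore s ρ i) = ENNReal.ofReal a := by
  have := Fintype.ofFinite ι
  classical
  -- The bound `R i` on the radius is harmless: the ball of radius `R i` has more measure than all
  -- cells together may have.
  have hR : ∀ i, ∃ R : ℝ, 0 ≤ R ∧ Fintype.card ι * ENNReal.ofReal a < μ (ball (s i) R) := by
    intro i
    have hmono : Monotone fun n : ℕ => ball (s i) (n : ℝ) :=
      fun m n h => ball_subset_ball (by exact_mod_cast h)
    have ht := tendsto_measure_iUnion_atTop (μ := μ) hmono
    rw [iUnion_ball_nat, huniv] at ht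
    have hlt : Fintype.card ι * ENNReal.ofReal a < ∞ :=
      ENNReal.mul_lt_top (ENNReal.natCast_lt_top _) ENNReal.ofReal_lt_top
    obtain ⟨n, hn⟩ := (ht.eventually (lt_mem_nhds hlt)).exists
    exact ⟨n, Nat.cast_nonneg n, hn⟩
  choose R hR0 hR using hR
  let S : Set (ι → ℝ) := Icc 0 R ∩ ⋂ i, {ρ | μ (cellCore s ρ i) ≤ ENNReal.ofReal a}
  have hcont : ∀ i, Continuous fun ρ : ι → ℝ => μ (cellCore s ρ i) := fun i =>
    continuous_iff_continuousAt.2 fun ρ => tendsto_measure_cellCore hs hμ ρ i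
  have hScl : IsCompact S := isCompact_Icc.inter_right
    (isClosed_iInter fun i => isClosed_le (hcont i) continuous_const)
  have h0S : (0 : ι → ℝ) ∈ S := by
    refine ⟨⟨le_rfl, hR0⟩, mem_iInter.2 fun i => ?_⟩
    have : cellCore s (0 : ι → ℝ) i = ∅ := by
      ext p; simp [cellCore, dist_nonneg.not_gt]
    simp [this]
  obtain ⟨ρ, hρ, hmax⟩ := hScl.exists_isMaxOn ⟨0, h0S⟩
    (f := fun ρ : ι → ℝ => ∑ i, ρ i) (by fun_prop)
  have hle : ∀ i, μ (cellCore s ρ i) ≤ ENNReal.ofReal a := fun i => mem_iInter.1 hρ.2 i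
  refine ⟨ρ, fun i => (hle i).antisymm (not_lt.1 fun hlt => ?_)⟩
  -- At `ρ i = R i` the cells would cover that ball up to a null set, although their total measure
  -- is at most the sum of the appetites.
  have hiR : ρ i < R i := by
    refine lt_of_le_of_ne (hρ.1.2 i) fun h => ?_
    have h0 : μ (wallSet s ρ) = 0 := le_antisymm ((hμ _).trans (volume_wallSet hs ρ).le) zero_le
    have hsub : ball (s i) (R i) ⊆ wallSet s ρ ∪ ⋃ j, cellCore s ρ j := by
      intro p hp
      by_cases hw : p ∈ wallSet s ρ
      · exact Or.inl hw
      · exact Or.inr (mem_iUnion.2 (exists_mem_cellCore hw (j := i) (by rw [h]; exact hp)))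
    have := calc
      μ (ball (s i) (R i)) ≤ μ (wallSet s ρ) + μ (⋃ j, cellCore s ρ j) :=
        (measure_mono hsub).trans (measure_union_le _ _)
      _ ≤ ∑ j, μ (cellCore s ρ j) := by
        rw [h0, zero_add]; exact measure_iUnion_fintype_le _ _
      _ ≤ ∑ _j : ι, ENNReal.ofReal a := Finset.sum_le_sum fun j _ => hle j
      _ = Fintype.card ι * ENNReal.ofReal a := by simp
    exact this.not_gt (hR i)
  have hupd : Continuous fun x : ℝ => Function.update ρ i x := by fun_prop
  have hev : ∀ᶠ x in 𝓝[>] (ρ i), μ (cellCore s (Function.update ρ i x) i) < ENNReal.ofReal a := by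
    have h1 : Tendsto (fun x : ℝ => μ (cellCore s (Function.update ρ i x) i)) (𝓝 (ρ i))
        (𝓝 (μ (cellCore s ρ i))) := by
      simpa [Function.comp_def] using ((hcont i).comp hupd).tendsto (ρ i)
    exact (h1.eventually (gt_mem_nhds hlt)).filter_mono nhdsWithin_le_nhds
  have hev2 : ∀ᶠ x in 𝓝[>] (ρ i), x ∈ Ioo (ρ i) (R i) := Ioo_mem_nhdsGT hiR
  obtain ⟨x, hx1, hx2⟩ := (hev.and hev2).exists
  have hle' : ρ ≤ Function.update ρ i x := by
    intro j
    rcases eq_or_ne j i with rfl | hj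
    · simpa using hx2.1.le
    · simp [hj]
  have hS : Function.update ρ i x ∈ S := by
    refine ⟨⟨hρ.1.1.trans hle', fun j => ?_⟩, mem_iInter.2 fun j => ?_⟩
    · rcases eq_or_ne j i with rfl | hj
      · simpa using hx2.2.le
      · simpa [hj] using hρ.1.2 j
    · rcases eq_or_ne j i with rfl | hj
      · exact hx1.le
      · exact (measure_mono (cellCore_mono (by simp [hj]) fun k _ => hle' k)).trans (hle j)
  have hlt' : ∑ j, ρ j < ∑ j, Function.update ρ i x j :=
    Finset.sum_lt_sum (fun j _ => hle' j) ⟨i, Finset.mem_univ i, by simpa using hx2.1⟩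
  exact (hmax hS).not_gt hlt'

/-- A family of cells inside a ball bounds the number of the cells. -/
theorem card_mul_le_of_radii_le [Finite ι] {s : ι → Plane} (hμ : μ ≤ volume)
    {ρ : ι → ℝ} {a : ℝ} (ha : ∀ i, μ (cellCore s ρ i) = ENNReal.ofReal a)
    (G : Finset ι) {z : Plane} {D η : ℝ} (hD : 0 ≤ D + η) (hG : ∀ g ∈ G, ρ g ≤ D)
    (hη : ∀ g ∈ G, dist (s g) z ≤ η) : G.card * a ≤ Real.pi * (D + η) ^ 2 := by
  have h1 : μ (⋃ g ∈ G, cellCore s ρ g) = G.card * ENNReal.ofReal a := by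
    rw [measure_biUnion_finset (fun i _ j _ hij => disjoint_cellCore s ρ hij)
      (fun i _ => (isOpen_cellCore s ρ i).measurableSet)]
    simp [ha]
  have h2 : (⋃ g ∈ G, cellCore s ρ g) ⊆ ball z (D + η) := by
    refine iUnion₂_subset fun g hg p hp => ?_
    have := dist_triangle p (s g) z
    have h3 : dist p (s g) < ρ g := hp.1
    rw [mem_ball]
    linarith [hG g hg, hη g hg]
  have h3 := (measure_mono h2).trans (hμ (ball z (D + η)))
  rw [h1, EuclideanSpace.volume_ball_fin_two, ← ENNReal.ofReal_natCast,
    ← ENNReal.ofReal_mul (Nat.cast_nonneg _), ← ENNReal.ofReal_pow hD,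
    ← ENNReal.ofReal_mul (by positivity), ENNReal.ofReal_le_ofReal_iff (by positivity)] at h3
  linarith

/-- Everything within the radius of a site is matched. -/
theorem pi_mul_sq_radius_le [Fintype ι] {s : ι → Plane} (hs : Function.Injective s)
    {ρ : ι → ℝ} {a : ℝ} (ha0 : 0 ≤ a) (ha : ∀ i, volume (cellCore s ρ i) = ENNReal.ofReal a)
    (i : ι) (hi : 0 ≤ ρ i) : Real.pi * ρ i ^ 2 ≤ Fintype.card ι * a := by
  have hsub : ball (s i) (ρ i) ⊆ wallSet s ρ ∪ ⋃ j, cellCore s ρ j := by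
    intro p hp
    by_cases hw : p ∈ wallSet s ρ
    · exact Or.inl hw
    · exact Or.inr (mem_iUnion.2 (exists_mem_cellCore hw (j := i) hp))
  have := calc
    volume (ball (s i) (ρ i)) ≤ volume (wallSet s ρ) + volume (⋃ j, cellCore s ρ j) :=
      (measure_mono hsub).trans (measure_union_le _ _)
    _ ≤ ∑ j, volume (cellCore s ρ j) := by
      rw [volume_wallSet hs, zero_add]; exact measure_iUnion_fintype_le _ _
    _ = ENNReal.ofReal (Fintype.card ι * a) := by
      simp [ha, ENNReal.ofReal_mul]
  rw [EuclideanSpace.volume_ball_fin_two, ← ENNReal.ofReal_pow hi,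
    ← ENNReal.ofReal_mul (by positivity), ENNReal.ofReal_le_ofReal_iff (by positivity)] at this
  linarith

end Existence

end Cells

/-! ### Local geometry of a notch: its face, segment, arc and corner -/

/-- The closed rectangle with center abscissa `x`, half width `ε`, ordinates from `y` to `y + t`. -/
def notchBox (x ε y t : ℝ) : Set Plane := {p | |p 0 - x| ≤ ε ∧ y ≤ p 1 ∧ p 1 ≤ y + t}

/-- The part of a vertical strip of width `ε` between the discs of radius `r` around `(0, y)` and
`(0, y + t)`. -/
def notchRegion (x ε y t r : ℝ) : Set Plane :=
  {p | |p 0 - x| ≤ ε / 2 ∧ (y ≤ p 1 ∧ p 1 ≤ y + t) ∧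
    r ^ 2 ≤ p 0 ^ 2 + (p 1 - y) ^ 2 ∧ r ^ 2 ≤ p 0 ^ 2 + (p 1 - (y + t)) ^ 2}

/-- The arc of the circle of radius `r` around `(0, y)` at the bottom of `notchRegion`. -/
def notchArc (x ε y r : ℝ) : Set Plane :=
  {p | |p 0 - x| ≤ ε / 2 ∧ y ≤ p 1 ∧ p 0 ^ 2 + (p 1 - y) ^ 2 = r ^ 2}

/-- Near the strip of the site `s A` with abscissa `x`, the discs of radius `r` around
`s P = (0, y)` and `s Q = (0, y + t)` are the only ones, apart from those of the sites in line with
`s A`, and leave a gap there, which is within the reach of `s A` and of its two neighbors. -/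
structure IsNotch {ι : Type*} (s : ι → Plane) (ρ : ι → ℝ) (A P Q : ι) (x ε y t r Y : ℝ) :
    Prop where
  ε_pos : 0 < ε
  t_pos : 0 < t
  r_pos : 0 < r
  A_zero : s A 0 = x
  A_one : s A 1 = Y
  P_zero : s P 0 = 0
  P_one : s P 1 = y
  Q_zero : s Q 0 = 0
  Q_one : s Q 1 = y + t
  radius_P : ρ P = r
  radius_Q : ρ Q = r
  pos : 0 < x - ε
  lt : x + ε < r
  gap : r ^ 2 < (x - ε) ^ 2 + (t / 2) ^ 2
  reach : ∀ p ∈ notchBox x ε y t, dist p (s A) < ρ A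
  left : ∃ B, s B 0 = x - ε ∧ s B 1 = Y ∧ ∀ p ∈ notchBox x ε y t, dist p (s B) < ρ B
  right : ∃ B, s B 0 = x + ε ∧ s B 1 = Y ∧ ∀ p ∈ notchBox x ε y t, dist p (s B) < ρ B
  others : ∀ k, k ≠ A → k ≠ P → k ≠ Q →
    (∀ p ∈ notchBox x ε y t, ρ k < dist p (s k)) ∨ (s k 1 = Y ∧ ε ≤ |s k 0 - x|)
  prefer_P : ∀ p, dist p (s P) ≤ r → dist p (s P) < dist p (s A)
  prefer_Q : ∀ p, dist p (s Q) ≤ r → dist p (s Q) < dist p (s A)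
  strip : ∀ p, dist p (s P) < r → |p 1 - y| < t / 2 → p ∈ cellCore s ρ P

namespace IsNotch

variable {ι : Type*} {s : ι → Plane} {ρ : ι → ℝ} {A P Q : ι} {x ε y t r Y : ℝ}

/-- The bisectors with the two neighbors in the row cut the box down to a strip of width `ε`, and
the two discs remove what the column sites prefer. -/
theorem notchRegion_subset_of_mem (h : IsNotch s ρ A P Q x ε y t r Y) {p : Plane}
    (hp : p ∈ notchBox x ε y t) (hA : p ∈ radiiDiagram s ρ (some A)) :
    p ∈ notchRegion x ε y t r := by
  obtain ⟨B, hB0, hB1, hB⟩ := h.left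
  obtain ⟨B', hB'0, hB'1, hB'⟩ := h.right
  have h1 := dist_le_dist_of_mem_radiiDiagram hA (hB p hp)
  have h2 := dist_le_dist_of_mem_radiiDiagram hA (hB' p hp)
  rw [← not_lt, Plane.dist_lt_dist_iff, not_lt, h.A_zero, h.A_one] at h1 h2
  rw [hB0, hB1] at h1
  rw [hB'0, hB'1] at h2
  have hε := h.ε_pos
  refine ⟨abs_le.2 ⟨by nlinarith, by nlinarith⟩, hp.2, ?_, ?_⟩
  · by_contra hlt
    have h3 : dist p (s P) < r := by
      rw [Plane.dist_lt_iff h.r_pos.le, h.P_zero, h.P_one]; simpa using hlt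
    have h4 := dist_le_dist_of_mem_radiiDiagram hA (j := P) (by rwa [h.radius_P])
    exact absurd (h.prefer_P p h3.le) (not_lt.2 h4)
  · by_contra hlt
    have h3 : dist p (s Q) < r := by
      rw [Plane.dist_lt_iff h.r_pos.le, h.Q_zero, h.Q_one]; simpa using hlt
    have h4 := dist_le_dist_of_mem_radiiDiagram hA (j := Q) (by rwa [h.radius_Q])
    exact absurd (h.prefer_Q p h3.le) (not_lt.2 h4)

theorem lt_dist_of_mem (h : IsNotch s ρ A P Q x ε y t r Y) {p : Plane} {k : ι}
    (hp : |p 0 - x| < ε / 2) (hk : s k 1 = Y) (hk' : ε ≤ |s k 0 - x|) :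
    dist p (s A) < dist p (s k) := by
  rw [Plane.dist_lt_dist_iff, h.A_zero, h.A_one, hk, add_lt_add_iff_right, sq_lt_sq]
  have := abs_sub_abs_le_abs_sub (s k 0 - x) (p 0 - x)
  rw [show s k 0 - x - (p 0 - x) = -(p 0 - s k 0) by ring, abs_neg] at this
  linarith

theorem core_of_mem (h : IsNotch s ρ A P Q x ε y t r Y) {p : Plane}
    (hp : |p 0 - x| < ε / 2) (hy : y ≤ p 1 ∧ p 1 ≤ y + t)
    (hP : r ^ 2 < p 0 ^ 2 + (p 1 - y) ^ 2) (hQ : r ^ 2 < p 0 ^ 2 + (p 1 - (y + t)) ^ 2) :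
    p ∈ cellCore s ρ A := by
  have hbox : p ∈ notchBox x ε y t := ⟨by linarith [h.ε_pos], hy⟩
  refine ⟨h.reach p hbox, fun k hk => ?_⟩
  by_cases hkP : k = P
  · left
    rw [hkP, h.radius_P, Plane.lt_dist_iff h.r_pos.le, h.P_zero, h.P_one]
    simpa using hP
  by_cases hkQ : k = Q
  · left
    rw [hkQ, h.radius_Q, Plane.lt_dist_iff h.r_pos.le, h.Q_zero, h.Q_one]
    simpa using hQ
  rcases h.others k hk hkP hkQ with h1 | ⟨h1, h2⟩
  · exact Or.inl (h1 p hbox)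
  · exact Or.inr (h.lt_dist_of_mem hp h1 h2)

theorem sqrt_lt (h : IsNotch s ρ A P Q x ε y t r Y) {u : ℝ} (hu : |u - x| ≤ ε) :
    Real.sqrt (r ^ 2 - u ^ 2) < t / 2 := by
  rw [Real.sqrt_lt' (half_pos h.t_pos)]
  have := abs_le.1 hu
  nlinarith [h.gap, h.pos]

theorem sqrt_pos (h : IsNotch s ρ A P Q x ε y t r Y) {u : ℝ} (hu : |u - x| ≤ ε) :
    0 < Real.sqrt (r ^ 2 - u ^ 2) := by
  rw [Real.sqrt_pos]
  have := abs_le.1 hu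
  nlinarith [h.lt, h.pos]

theorem sq_sqrt (h : IsNotch s ρ A P Q x ε y t r Y) {u : ℝ} (hu : |u - x| ≤ ε) :
    Real.sqrt (r ^ 2 - u ^ 2) ^ 2 = r ^ 2 - u ^ 2 :=
  Real.sq_sqrt (Real.sqrt_pos.1 (h.sqrt_pos hu)).le

/-- A parametrization of `notchRegion` over a rectangle. -/
noncomputable def param (y t r : ℝ) (q : ℝ × ℝ) : Plane :=
  !₂[q.1, y + t / 2 + q.2 * (t / 2 - Real.sqrt (r ^ 2 - q.1 ^ 2))]

theorem continuous_param (y t r : ℝ) : Continuous (param y t r) := by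
  unfold param
  refine (PiLp.continuous_toLp 2 _).comp (continuous_pi fun i => ?_)
  fin_cases i
  · exact continuous_fst
  · simp only [Fin.mk_one, Matrix.cons_val_one, Matrix.cons_val_fin_one]
    fun_prop

theorem notchRegion_subset_image (h : IsNotch s ρ A P Q x ε y t r Y) :
    notchRegion x ε y t r ⊆
      param y t r '' (Icc (x - ε / 2) (x + ε / 2) ×ˢ Icc (-1 : ℝ) 1) := by
  rintro p ⟨h1, h2, h3, h4⟩
  have hu : |p 0 - x| ≤ ε := by linarith [h.ε_pos]
  have hpos : 0 < t / 2 - Real.sqrt (r ^ 2 - p 0 ^ 2) := by linarith [h.sqrt_lt hu]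
  have hw : Real.sqrt (r ^ 2 - p 0 ^ 2) ≤ p 1 - y :=
    Real.sqrt_le_iff.2 ⟨by linarith, by linarith⟩
  have hw' : Real.sqrt (r ^ 2 - p 0 ^ 2) ≤ y + t - p 1 :=
    Real.sqrt_le_iff.2 ⟨by linarith, by nlinarith⟩
  -- On each vertical line the region is an interval centered at height `y + t / 2`; dividing by its
  -- half length gives the second parameter.
  refine ⟨(p 0, (p 1 - y - t / 2) / (t / 2 - Real.sqrt (r ^ 2 - p 0 ^ 2))), ⟨?_, ?_⟩, ?_⟩
  · have := abs_le.1 h1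
    exact ⟨by simp only; linarith, by simp only; linarith⟩
  · exact ⟨by rw [le_div_iff₀ hpos]; linarith, by rw [div_le_iff₀ hpos]; linarith⟩
  · ext i
    fin_cases i
    · simp [param]
    · simp [param, div_mul_cancel₀ _ hpos.ne']

theorem image_subset_notchRegion (h : IsNotch s ρ A P Q x ε y t r Y) :
    param y t r '' (Icc (x - ε / 2) (x + ε / 2) ×ˢ Icc (-1 : ℝ) 1) ⊆
      notchRegion x ε y t r := by
  rintro _ ⟨⟨u, σ⟩, ⟨⟨h1, h2⟩, h3, h4⟩, rfl⟩
  simp only at h1 h2 h3 h4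
  have hu' : |u - x| ≤ ε / 2 := abs_le.2 ⟨by linarith, by linarith⟩
  have hu : |u - x| ≤ ε := by linarith [h.ε_pos]
  have e1 := h.sqrt_lt hu
  have e2 := h.sqrt_pos hu
  have e3 := h.sq_sqrt hu
  have ht := h.t_pos
  simp only [notchRegion, param, mem_ofPred_eq, Matrix.cons_val_zero, Matrix.cons_val_one,
    Matrix.cons_val_fin_one]
  set w := Real.sqrt (r ^ 2 - u ^ 2)
  have f1 : w ≤ t / 2 + σ * (t / 2 - w) := by nlinarith
  have f2 : t / 2 + σ * (t / 2 - w) ≤ t - w := by nlinarith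
  refine ⟨hu', ⟨by linarith, by linarith⟩, ?_, ?_⟩
  · rw [show y + t / 2 + σ * (t / 2 - w) - y = t / 2 + σ * (t / 2 - w) by ring]
    nlinarith
  · rw [show y + t / 2 + σ * (t / 2 - w) - (y + t) = -(t - (t / 2 + σ * (t / 2 - w))) by ring]
    nlinarith

theorem image_subset_cellCore (h : IsNotch s ρ A P Q x ε y t r Y) :
    param y t r '' (Ioo (x - ε / 2) (x + ε / 2) ×ˢ Ioo (-1 : ℝ) 1) ⊆ cellCore s ρ A := by
  rintro _ ⟨⟨u, σ⟩, ⟨⟨h1, h2⟩, h3, h4⟩, rfl⟩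
  simp only at h1 h2 h3 h4
  have hu' : |u - x| < ε / 2 := abs_lt.2 ⟨by linarith, by linarith⟩
  have hu : |u - x| ≤ ε := by linarith [h.ε_pos]
  have e1 := h.sqrt_lt hu
  have e2 := h.sqrt_pos hu
  have e3 := h.sq_sqrt hu
  have ht := h.t_pos
  set w := Real.sqrt (r ^ 2 - u ^ 2) with hw
  have f1 : w < t / 2 + σ * (t / 2 - w) := by nlinarith
  have f2 : t / 2 + σ * (t / 2 - w) < t - w := by nlinarith
  refine h.core_of_mem ?_ ?_ ?_ ?_ <;> simp only [param, Matrix.cons_val_zero, Matrix.cons_val_one,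
    Matrix.cons_val_fin_one, ← hw]
  · exact hu'
  · exact ⟨by linarith, by linarith⟩
  · rw [show y + t / 2 + σ * (t / 2 - w) - y = t / 2 + σ * (t / 2 - w) by ring]
    nlinarith
  · rw [show y + t / 2 + σ * (t / 2 - w) - (y + t) = -(t - (t / 2 + σ * (t / 2 - w))) by ring]
    nlinarith

/-- The open parameter rectangle maps into the core; continuity carries this over to the closures.
-/
theorem notchRegion_subset (h : IsNotch s ρ A P Q x ε y t r Y) :
    notchRegion x ε y t r ⊆ radiiDiagram s ρ (some A) := by
  have h1 : closure (Ioo (x - ε / 2) (x + ε / 2) ×ˢ Ioo (-1 : ℝ) 1) =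
      Icc (x - ε / 2) (x + ε / 2) ×ˢ Icc (-1 : ℝ) 1 := by
    rw [closure_prod_eq, closure_Ioo (by linarith [h.ε_pos]), closure_Ioo (by norm_num)]
  refine h.notchRegion_subset_image.trans ?_
  rw [← h1]
  exact (image_closure_subset_closure_image (continuous_param y t r)).trans
    (closure_mono h.image_subset_cellCore)

theorem isPreconnected_notchRegion (h : IsNotch s ρ A P Q x ε y t r Y) :
    IsPreconnected (notchRegion x ε y t r) := by
  rw [h.notchRegion_subset_image.antisymm h.image_subset_notchRegion]
  exact (isPreconnected_Icc.prod isPreconnected_Icc).image _ (continuous_param y t r).continuousOn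

/-- In the closed box the cell is contained in the region, and the region lies in the open box
because the discs overlap the whole left, right, top and bottom approach within the strip. So the
cell misses the boundary of the box, and a connected piece cannot leave. -/
theorem connectedComponentIn_eq_notchRegion (h : IsNotch s ρ A P Q x ε y t r Y) {p : Plane}
    (hp : p ∈ notchRegion x ε y t r) :
    connectedComponentIn (radiiDiagram s ρ (some A)) p = notchRegion x ε y t r := by
  refine Subset.antisymm ?_
    (h.isPreconnected_notchRegion.subset_connectedComponentIn hp h.notchRegion_subset)
  have hzone : IsClosed (notchBox x ε y t) := by
    have : notchBox x ε y t = {p | |p 0 - x| ≤ ε} ∩ ({p | y ≤ p 1} ∩ {p | p 1 ≤ y + t}) := rfl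
    rw [this]
    refine IsClosed.inter (isClosed_le (by fun_prop) (by fun_prop)) (IsClosed.inter ?_ ?_) <;>
      exact isClosed_le (by fun_prop) (by fun_prop)
  have hopen : IsOpen {p : Plane | |p 0 - x| < ε ∧ y < p 1 ∧ p 1 < y + t} := by
    have : {p : Plane | |p 0 - x| < ε ∧ y < p 1 ∧ p 1 < y + t} =
      {p | |p 0 - x| < ε} ∩ ({p | y < p 1} ∩ {p | p 1 < y + t}) := rfl
    rw [this]
    refine IsOpen.inter (isOpen_lt (by fun_prop) (by fun_prop)) (IsOpen.inter ?_ ?_) <;>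
      exact isOpen_lt (by fun_prop) (by fun_prop)
  have hsub : notchRegion x ε y t r ⊆ {p : Plane | |p 0 - x| < ε ∧ y < p 1 ∧ p 1 < y + t} := by
    rintro q ⟨h1, ⟨h2, h3⟩, h4, h5⟩
    have hq := abs_le.1 h1
    have hlt : q 0 ^ 2 < r ^ 2 := by nlinarith [h.lt, h.pos, h.ε_pos]
    refine ⟨by linarith [h.ε_pos], lt_of_le_of_ne h2 fun h' => ?_, lt_of_le_of_ne h3 fun h' => ?_⟩
    · rw [← h', sub_self] at h4
      nlinarith
    · rw [h', sub_self] at h5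
      nlinarith
  have hCA : connectedComponentIn (radiiDiagram s ρ (some A)) p ⊆ radiiDiagram s ρ (some A) :=
    connectedComponentIn_subset _ _
  -- The open box and the complement of the closed box separate the cell.
  have hmain := isPreconnected_connectedComponentIn.subset_left_of_subset_union
    (s := connectedComponentIn (radiiDiagram s ρ (some A)) p) hopen hzone.isOpen_compl
    (by
      rw [Set.disjoint_compl_right_iff_subset]
      exact fun q hq => ⟨hq.1.le, hq.2.1.le, hq.2.2.le⟩)
    (fun q hq => by
      by_cases hqz : q ∈ notchBox x ε y t
      · exact Or.inl (hsub (h.notchRegion_subset_of_mem hqz (hCA hq)))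
      · exact Or.inr hqz)
    ⟨p, mem_connectedComponentIn (h.notchRegion_subset hp), hsub hp⟩
  intro q hq
  have := hmain hq
  exact h.notchRegion_subset_of_mem ⟨this.1.le, this.2.1.le, this.2.2.le⟩ (hCA hq)

/-- The middle of a notch. -/
noncomputable def center (x y t : ℝ) : Plane := !₂[x, y + t / 2]

theorem center_mem (h : IsNotch s ρ A P Q x ε y t r Y) :
    center x y t ∈ notchRegion x ε y t r := by
  have hmem : ((x, 0) : ℝ × ℝ) ∈ Icc (x - ε / 2) (x + ε / 2) ×ˢ Icc (-1 : ℝ) 1 := by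
    have := h.ε_pos
    refine ⟨⟨?_, ?_⟩, ?_⟩
    · simp only; linarith
    · simp only; linarith
    · norm_num
  have := h.image_subset_notchRegion (mem_image_of_mem (param y t r) hmem)
  simpa [param, center] using this

theorem notchRegion_mem_componentsOf (h : IsNotch s ρ A P Q x ε y t r Y) :
    notchRegion x ε y t r ∈ componentsOf (radiiDiagram s ρ (some A)) := by
  exact ⟨_, h.notchRegion_subset h.center_mem,
    (h.connectedComponentIn_eq_notchRegion h.center_mem).symm⟩

theorem notchRegion_ne (h : IsNotch s ρ A P Q x ε y t r Y) {x' ε' y' t' r' : ℝ}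
    (hx : ε' / 2 < |x - x'|) : notchRegion x ε y t r ≠ notchRegion x' ε' y' t' r' := by
  intro heq
  have h1 := h.center_mem
  rw [heq] at h1
  have := h1.1
  simp only [center, Matrix.cons_val_zero] at this
  linarith

theorem notchRegion_mem_faces (h : IsNotch s ρ A P Q x ε y t r Y) :
    notchRegion x ε y t r ∈ faces (radiiDiagram s ρ) :=
  ⟨_, h.notchRegion_mem_componentsOf⟩

/-- The bottom right corner of a notch. -/
noncomputable def corner (x ε y r : ℝ) : Plane :=
  !₂[x + ε / 2, y + Real.sqrt (r ^ 2 - (x + ε / 2) ^ 2)]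

/-- The top right corner of a notch. -/
noncomputable def corner' (x ε y t r : ℝ) : Plane :=
  !₂[x + ε / 2, y + t - Real.sqrt (r ^ 2 - (x + ε / 2) ^ 2)]

theorem inter_eq_segment (h : IsNotch s ρ A P Q x ε y t r Y) :
    notchRegion x ε y t r ∩ notchRegion (x + ε) ε y t r =
      segment ℝ (corner x ε y r) (corner' x ε y t r) := by
  have hε := h.ε_pos
  have hu : |x + ε / 2 - x| ≤ ε := by
    rw [show x + ε / 2 - x = ε / 2 by ring, abs_of_pos (half_pos hε)]; linarith
  have e1 := h.sqrt_lt hu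
  have e2 := h.sqrt_pos hu
  have e3 := h.sq_sqrt hu
  unfold corner corner'
  set w := Real.sqrt (r ^ 2 - (x + ε / 2) ^ 2)
  rw [segment_eq_image]
  apply Subset.antisymm
  · rintro p ⟨⟨h1, h2, h3, h4⟩, h5, -⟩
    have h1' := abs_le.1 h1
    have h5' := abs_le.1 h5
    have hp0 : p 0 = x + ε / 2 := by linarith
    rw [hp0] at h3 h4
    have f1 : w ≤ p 1 - y := abs_le_of_sq_le_sq' (by linarith) (by linarith) |>.2
    have f2 : w ≤ y + t - p 1 := abs_le_of_sq_le_sq' (by nlinarith) (by linarith) |>.2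
    have hpos : 0 < t - 2 * w := by linarith
    have hθ := div_mul_cancel₀ (p 1 - y - w) hpos.ne'
    refine ⟨(p 1 - y - w) / (t - 2 * w), ⟨by apply div_nonneg <;> linarith, ?_⟩, ?_⟩
    · rw [div_le_one hpos]; linarith
    · ext i
      fin_cases i
      · simp [hp0]; ring
      · simp only [Fin.mk_one, PiLp.add_apply, PiLp.smul_apply, Matrix.cons_val_one,
          Matrix.cons_val_fin_one, smul_eq_mul]
        linear_combination hθ
  · rintro _ ⟨θ, ⟨h1, h2⟩, rfl⟩
    have f1 : w ≤ (1 - θ) * (y + w) + θ * (y + t - w) - y := by nlinarith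
    have f2 : (1 - θ) * (y + w) + θ * (y + t - w) - y ≤ t - w := by nlinarith
    have f0 : (1 - θ) * (x + ε / 2) + θ * (x + ε / 2) = x + ε / 2 := by ring
    constructor <;> simp only [notchRegion, mem_ofPred_eq, PiLp.add_apply, PiLp.smul_apply,
      Matrix.cons_val_zero, Matrix.cons_val_one, Matrix.cons_val_fin_one, smul_eq_mul, f0]
    · refine ⟨?_, ⟨by linarith, by linarith⟩, by nlinarith, by nlinarith⟩
      rw [show x + ε / 2 - x = ε / 2 by ring, abs_of_pos (half_pos hε)]
    · refine ⟨?_, ⟨by linarith, by linarith⟩, by nlinarith, by nlinarith⟩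
      rw [show x + ε / 2 - (x + ε) = -(ε / 2) by ring, abs_neg, abs_of_pos (half_pos hε)]

theorem segment_mem_straightEdges {A' : ι} (h : IsNotch s ρ A P Q x ε y t r Y)
    (h' : IsNotch s ρ A' P Q (x + ε) ε y t r Y) :
    segment ℝ (corner x ε y r) (corner' x ε y t r) ∈ straightEdges (radiiDiagram s ρ) := by
  have hε := h.ε_pos
  refine ⟨_, h.notchRegion_mem_faces, _, h'.notchRegion_mem_faces, h.notchRegion_ne ?_,
    ⟨⟨_, _, fun heq => ?_, rfl⟩, h.inter_eq_segment.ge⟩, fun E hE _ => ?_⟩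
  · rw [show x - (x + ε) = -ε by ring, abs_neg, abs_of_pos hε]; linarith
  · have hu : |x + ε / 2 - x| ≤ ε := by
      rw [show x + ε / 2 - x = ε / 2 by ring, abs_of_pos (half_pos hε)]; linarith
    have e1 := h.sqrt_lt hu
    have := congrArg (fun p : Plane => p 1) heq
    simp only [corner, corner', Matrix.cons_val_one, Matrix.cons_val_fin_one] at this
    linarith
  · rw [← h.inter_eq_segment]; exact hE.2

theorem notchArc_eq_image (h : IsNotch s ρ A P Q x ε y t r Y) :
    notchArc x ε y r = circlePoint (s P) r ''
      Icc (Real.arccos ((x + ε / 2) / r)) (Real.arccos ((x - ε / 2) / r)) := by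
  have hr := h.r_pos
  have hε := h.ε_pos
  have hx := h.pos
  have hx' := h.lt
  apply Subset.antisymm
  · rintro p ⟨h1, h2, h3⟩
    have h1' := abs_le.1 h1
    have hle : p 0 / r ≤ 1 := by rw [div_le_one hr]; linarith
    have hge : -1 ≤ p 0 / r := by rw [le_div_iff₀ hr]; linarith
    refine ⟨Real.arccos (p 0 / r), ⟨Real.arccos_le_arccos ?_, Real.arccos_le_arccos ?_⟩, ?_⟩
    · gcongr; linarith
    · gcongr; linarith
    · have hsin : Real.sin (Real.arccos (p 0 / r)) = (p 1 - y) / r := by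
        rw [Real.sin_arccos, ← Real.sqrt_sq (div_nonneg (sub_nonneg.2 h2) hr.le)]
        congr 1
        field_simp
        linarith
      ext i
      fin_cases i
      · simp only [circlePoint, Real.cos_arccos hge hle, h.P_zero]
        simp; field_simp
      · simp only [circlePoint, hsin, h.P_one]
        simp; field_simp; ring
  · rintro _ ⟨θ, ⟨h1, h2⟩, rfl⟩
    have hθ0 : 0 ≤ θ := (Real.arccos_nonneg _).trans h1
    have hθπ : θ ≤ Real.pi := h2.trans (Real.arccos_le_pi _)
    have hsin := Real.sin_nonneg_of_nonneg_of_le_pi hθ0 hθπ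
    have c1 : Real.cos θ ≤ (x + ε / 2) / r := by
      rw [← Real.cos_arccos (x := (x + ε / 2) / r) (by rw [le_div_iff₀ hr]; linarith)
        (by rw [div_le_one hr]; linarith)]
      exact Real.cos_le_cos_of_nonneg_of_le_pi (Real.arccos_nonneg _) hθπ h1
    have c2 : (x - ε / 2) / r ≤ Real.cos θ := by
      rw [← Real.cos_arccos (x := (x - ε / 2) / r) (by rw [le_div_iff₀ hr]; linarith)
        (by rw [div_le_one hr]; linarith)]
      exact Real.cos_le_cos_of_nonneg_of_le_pi hθ0 (Real.arccos_le_pi _) h2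
    rw [le_div_iff₀ hr] at c1
    rw [div_le_iff₀ hr] at c2
    simp only [notchArc, circlePoint, mem_ofPred_eq, Matrix.cons_val_zero, Matrix.cons_val_one,
      Matrix.cons_val_fin_one, h.P_zero, h.P_one]
    refine ⟨abs_le.2 ⟨by linarith, by linarith⟩, by nlinarith, ?_⟩
    have := Real.sin_sq_add_cos_sq θ
    linear_combination r ^ 2 * this

theorem abs_lt_of_mem_image_Ioo (h : IsNotch s ρ A P Q x ε y t r Y) {p : Plane}
    (hp : p ∈ circlePoint (s P) r ''
      Ioo (Real.arccos ((x + ε / 2) / r)) (Real.arccos ((x - ε / 2) / r))) :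
    |p 0 - x| < ε / 2 := by
  have hr := h.r_pos
  have hε := h.ε_pos
  have hx := h.pos
  have hx' := h.lt
  obtain ⟨θ, ⟨h1, h2⟩, rfl⟩ := hp
  have hθ0 : 0 ≤ θ := (Real.arccos_nonneg _).trans h1.le
  have hθπ : θ ≤ Real.pi := h2.le.trans (Real.arccos_le_pi _)
  have c1 : Real.cos θ < (x + ε / 2) / r := by
    rw [← Real.cos_arccos (x := (x + ε / 2) / r) (by rw [le_div_iff₀ hr]; linarith)
      (by rw [div_le_one hr]; linarith)]
    exact Real.cos_lt_cos_of_nonneg_of_le_pi (Real.arccos_nonneg _) hθπ h1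
  have c2 : (x - ε / 2) / r < Real.cos θ := by
    rw [← Real.cos_arccos (x := (x - ε / 2) / r) (by rw [le_div_iff₀ hr]; linarith)
      (by rw [div_le_one hr]; linarith)]
    exact Real.cos_lt_cos_of_nonneg_of_le_pi hθ0 (Real.arccos_le_pi _) h2
  rw [lt_div_iff₀ hr] at c1
  rw [div_lt_iff₀ hr] at c2
  simp only [circlePoint, Matrix.cons_val_zero, h.P_zero]
  exact abs_lt.2 ⟨by linarith, by linarith⟩

theorem continuous_circlePoint (z : Plane) (r : ℝ) : Continuous (circlePoint z r) := by
  unfold circlePoint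
  refine (PiLp.continuous_toLp 2 _).comp (continuous_pi fun i => ?_)
  fin_cases i
  · simp only [Fin.zero_eta, Matrix.cons_val_zero]
    fun_prop
  · simp only [Fin.mk_one, Matrix.cons_val_one, Matrix.cons_val_fin_one]
    fun_prop

theorem isPreconnected_notchArc (h : IsNotch s ρ A P Q x ε y t r Y) :
    IsPreconnected (notchArc x ε y r) := by
  rw [h.notchArc_eq_image]
  exact isPreconnected_Icc.image _ (continuous_circlePoint _ _).continuousOn

theorem isArcWithInterior_notchArc (h : IsNotch s ρ A P Q x ε y t r Y) :
    IsArcWithInterior (notchArc x ε y r) (circlePoint (s P) r ''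
      Ioo (Real.arccos ((x + ε / 2) / r)) (Real.arccos ((x - ε / 2) / r))) := by
  have hr := h.r_pos
  refine ⟨s P, r, _, _, hr, ?_, ?_, h.notchArc_eq_image, rfl⟩
  · refine Real.strictAntiOn_arccos ⟨?_, ?_⟩ ⟨?_, ?_⟩ ?_
    · rw [le_div_iff₀ hr]; linarith [h.pos, h.ε_pos]
    · rw [div_le_one hr]; linarith [h.lt, h.ε_pos]
    · rw [le_div_iff₀ hr]; linarith [h.pos, h.ε_pos]
    · rw [div_le_one hr]; linarith [h.lt, h.ε_pos]
    · gcongr; linarith [h.ε_pos]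
  · linarith [Real.arccos_nonneg ((x + ε / 2) / r), Real.arccos_le_pi ((x - ε / 2) / r),
      Real.pi_pos]

theorem sub_lt_of_mem_notchArc (h : IsNotch s ρ A P Q x ε y t r Y) {p : Plane}
    (hp : p ∈ notchArc x ε y r) : p 1 - y < t / 2 := by
  obtain ⟨h1, h2, h3⟩ := hp
  have h1' := abs_le.1 h1
  have hsq : (x - ε) ^ 2 ≤ p 0 ^ 2 := by
    have := h.pos; have := h.ε_pos; nlinarith
  have := h.gap
  exact lt_of_pow_lt_pow_left₀ 2 (half_pos h.t_pos).le (by linarith)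

theorem notchArc_subset_notchRegion (h : IsNotch s ρ A P Q x ε y t r Y) :
    notchArc x ε y r ⊆ notchRegion x ε y t r := by
  intro p hp
  have h4 := h.sub_lt_of_mem_notchArc hp
  obtain ⟨h1, h2, h3⟩ := hp
  have ht := h.t_pos
  exact ⟨h1, ⟨h2, by linarith⟩, h3.ge, by nlinarith⟩

/-- Below half the spacing, the open disc belongs to the site of `P`; an arc point is the limit of
points on the radius towards it. -/
theorem notchArc_subset_disc (h : IsNotch s ρ A P Q x ε y t r Y) :
    notchArc x ε y r ⊆ radiiDiagram s ρ (some P) := by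
  intro p hp
  have h4 := h.sub_lt_of_mem_notchArc hp
  obtain ⟨h1, h2, h3⟩ := hp
  have hr := h.r_pos
  have hlim : Tendsto (fun θ : ℝ => s P + θ • (p - s P)) (𝓝[<] 1) (𝓝 p) := by
    have : Continuous fun θ : ℝ => s P + θ • (p - s P) := by fun_prop
    have h5 := this.tendsto 1
    simp only [one_smul, add_sub_cancel] at h5
    exact h5.mono_left nhdsWithin_le_nhds
  refine mem_closure_of_tendsto hlim ?_
  filter_upwards [Ioo_mem_nhdsLT (show (0 : ℝ) < 1 by norm_num)] with θ hθ
  refine h.strip _ ?_ ?_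
  · rw [Plane.dist_lt_iff hr.le]
    simp only [PiLp.add_apply, PiLp.smul_apply, PiLp.sub_apply, smul_eq_mul, h.P_zero, h.P_one]
    have h5 : θ ^ 2 < 1 := by nlinarith [hθ.1, hθ.2]
    have : (0 + θ * (p 0 - 0) - 0) ^ 2 + (y + θ * (p 1 - y) - y) ^ 2 = θ ^ 2 * r ^ 2 := by
      rw [← h3]; ring
    rw [this]
    nlinarith [sq_pos_of_pos hr]
  · simp only [PiLp.add_apply, PiLp.smul_apply, PiLp.sub_apply, smul_eq_mul, h.P_one]
    rw [add_sub_cancel_left, abs_of_nonneg (mul_nonneg hθ.1.le (by linarith))]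
    nlinarith [hθ.1, hθ.2]

theorem inter_eq_notchArc (h : IsNotch s ρ A P Q x ε y t r Y) {p : Plane}
    (hp : p ∈ notchArc x ε y r) :
    notchRegion x ε y t r ∩ connectedComponentIn (radiiDiagram s ρ (some P)) p =
      notchArc x ε y r := by
  apply Subset.antisymm
  · rintro q ⟨⟨h1, h2, h3, -⟩, hq⟩
    have hq' := dist_le_of_mem_radiiDiagram (connectedComponentIn_subset _ _ hq)
    rw [h.radius_P, Plane.dist_le_iff h.r_pos.le, h.P_zero, h.P_one, sub_zero] at hq'
    exact ⟨h1, h2.1, hq'.antisymm h3⟩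
  · exact subset_inter h.notchArc_subset_notchRegion
      (h.isPreconnected_notchArc.subset_connectedComponentIn hp h.notchArc_subset_disc)

/-- At an inner point of the arc the disc of `Q` is out of reach, the other row sites are strictly
farther than `A`, and `A` reaches the point, so it is not in the empty region either. -/
theorem eq_of_mem_arc (h : IsNotch s ρ A P Q x ε y t r Y) {p : Plane}
    (hp : p ∈ notchArc x ε y r) (hlt : |p 0 - x| < ε / 2) {o : Option ι}
    (ho : p ∈ radiiDiagram s ρ o) : o = some A ∨ o = some P := by
  have hreg := h.notchArc_subset_notchRegion hp
  have hbox : p ∈ notchBox x ε y t := ⟨by linarith [h.ε_pos], hreg.2.1⟩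
  have hreach := h.reach p hbox
  cases o with
  | none => exact absurd hreach (not_lt.2 (le_dist_of_mem_radiiDiagram_none A ho))
  | some k =>
    by_contra hk
    push Not at hk
    have hkA : k ≠ A := fun h => hk.1 (by rw [h])
    have hkP : k ≠ P := fun h => hk.2 (by rw [h])
    have hle := dist_le_of_mem_radiiDiagram ho
    by_cases hkQ : k = Q
    · rw [hkQ, h.radius_Q, Plane.dist_le_iff h.r_pos.le, h.Q_zero, h.Q_one, sub_zero] at hle
      have h4 := h.sub_lt_of_mem_notchArc hp
      obtain ⟨h1, h2, h3⟩ := hp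
      have := h.t_pos
      nlinarith
    · rcases h.others k hkA hkP hkQ with h1 | ⟨h1, h2⟩
      · exact absurd (h1 p hbox) (not_lt.2 hle)
      · exact absurd (h.lt_dist_of_mem hlt h1 h2)
          (not_lt.2 (dist_le_dist_of_mem_radiiDiagram ho hreach))

/-- Only two faces contain an inner point of the arc, and they meet exactly in the arc. So no second
maximal arc passes there, which excludes tangency points. -/
theorem eq_notchArc_of_mem_maximalArcs (h : IsNotch s ρ A P Q x ε y t r Y) {p : Plane}
    (hp : p ∈ notchArc x ε y r) (hlt : |p 0 - x| < ε / 2) {E : Set Plane}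
    (hE : E ∈ maximalArcs (radiiDiagram s ρ)) (hpE : p ∈ E) : E = notchArc x ε y r := by
  obtain ⟨F, ⟨o, z, hz, rfl⟩, F', ⟨o', z', hz', rfl⟩, hne, ⟨hE1, hE2⟩, hmax⟩ := hE
  have key : ∀ {o z}, p ∈ connectedComponentIn (radiiDiagram s ρ o) z →
      connectedComponentIn (radiiDiagram s ρ o) z = notchRegion x ε y t r ∨
      connectedComponentIn (radiiDiagram s ρ o) z =
        connectedComponentIn (radiiDiagram s ρ (some P)) p := by
    intro o z hpz
    have h1 := connectedComponentIn_eq hpz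
    rcases h.eq_of_mem_arc hp hlt (connectedComponentIn_subset _ _ hpz) with rfl | rfl
    · left
      rw [h1, h.connectedComponentIn_eq_notchRegion (h.notchArc_subset_notchRegion hp)]
    · exact Or.inr h1
  have hinter : connectedComponentIn (radiiDiagram s ρ o) z ∩
      connectedComponentIn (radiiDiagram s ρ o') z' = notchArc x ε y r := by
    rcases key (hE2 hpE).1 with h1 | h1 <;> rcases key (hE2 hpE).2 with h2 | h2
    · exact absurd (h1.trans h2.symm) hne
    · rw [h1, h2, h.inter_eq_notchArc hp]
    · rw [h1, h2, inter_comm, h.inter_eq_notchArc hp]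
    · exact absurd (h1.trans h2.symm) hne
  rw [hinter] at hE2 hmax
  exact hE2.antisymm (hmax ⟨⟨_, h.isArcWithInterior_notchArc⟩, Subset.rfl⟩ hE2)

theorem corner_mem_notchArc (h : IsNotch s ρ A P Q x ε y t r Y) :
    corner x ε y r ∈ notchArc x ε y r := by
  have hε := h.ε_pos
  have hu : |x + ε / 2 - x| ≤ ε / 2 := by
    rw [show x + ε / 2 - x = ε / 2 by ring, abs_of_pos (half_pos hε)]
  have e3 := h.sq_sqrt (u := x + ε / 2) (by linarith)
  simp only [notchArc, corner, mem_ofPred_eq, Matrix.cons_val_zero, Matrix.cons_val_one,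
    Matrix.cons_val_fin_one, add_sub_cancel_left, e3]
  refine ⟨by rwa [add_sub_cancel_left] at hu, ?_, by ring⟩
  linarith [Real.sqrt_nonneg (r ^ 2 - (x + ε / 2) ^ 2)]

theorem notchArc_mem_curvedEdges (h : IsNotch s ρ A P Q x ε y t r Y) :
    notchArc x ε y r ∈ curvedEdges (radiiDiagram s ρ) := by
  have hc := h.corner_mem_notchArc
  have hinter := h.inter_eq_notchArc hc
  refine ⟨_, h.notchRegion_mem_faces, _, ⟨some P, _, h.notchArc_subset_disc hc, rfl⟩, ?_,
    ⟨⟨_, h.isArcWithInterior_notchArc, ?_⟩, hinter.ge⟩, fun E hE _ => by rw [← hinter]; exact hE.2⟩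
  · intro heq
    rw [← heq, inter_self] at hinter
    have h1 := h.center_mem
    rw [hinter] at h1
    have := h.sub_lt_of_mem_notchArc h1
    simp only [center, Matrix.cons_val_one, Matrix.cons_val_fin_one] at this
    linarith
  · rw [Set.disjoint_left]
    rintro p hp ⟨E₁, hE₁, E₂, hE₂, hne, ⟨I₁, hI₁, hp₁⟩, ⟨I₂, hI₂, hp₂⟩⟩
    have hsub : ∀ {E I : Set Plane}, IsArcWithInterior E I → I ⊆ E := by
      rintro E I ⟨z, r, α, β, -, -, -, rfl, rfl⟩
      exact image_mono Ioo_subset_Icc_self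
    have hlt := h.abs_lt_of_mem_image_Ioo hp
    have hpA : p ∈ notchArc x ε y r := hsub h.isArcWithInterior_notchArc hp
    exact hne ((h.eq_notchArc_of_mem_maximalArcs hpA hlt hE₁ (hsub hI₁ hp₁)).trans
      (h.eq_notchArc_of_mem_maximalArcs hpA hlt hE₂ (hsub hI₂ hp₂)).symm)

theorem corner_mem_vertices {A' : ι} (h : IsNotch s ρ A P Q x ε y t r Y)
    (h' : IsNotch s ρ A' P Q (x + ε) ε y t r Y) :
    corner x ε y r ∈ vertices (radiiDiagram s ρ) := by
  refine ⟨_, Or.inl (h.segment_mem_straightEdges h'), _, Or.inr h.notchArc_mem_curvedEdges, ?_,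
    left_mem_segment ℝ _ _, h.corner_mem_notchArc⟩
  intro heq
  have h1 := right_mem_segment ℝ (corner x ε y r) (corner' x ε y t r)
  rw [heq] at h1
  have h2 := h.sub_lt_of_mem_notchArc h1
  have hε := h.ε_pos
  have hu : |x + ε / 2 - x| ≤ ε := by
    rw [show x + ε / 2 - x = ε / 2 by ring, abs_of_pos (half_pos hε)]; linarith
  have e1 := h.sqrt_lt hu
  simp only [corner', Matrix.cons_val_one, Matrix.cons_val_fin_one] at h2
  linarith

end IsNotch

/-! ### Counting faces, edges and vertices over a grid of notches -/

theorem Nat.eq_of_mul_lt_mul {i j : ℕ} {e : ℝ} (he : 0 < e) (h1 : (i : ℝ) * e < (j + 1) * e)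
    (h2 : (j : ℝ) * e < (i + 1) * e) : i = j := by
  have h1' := lt_of_mul_lt_mul_right h1 he.le
  have h2' := lt_of_mul_lt_mul_right h2 he.le
  norm_cast at h1' h2'
  omega

theorem Set.mul_le_encard_of_injective {α : Type*} {I J : ℕ} {S : Set α} (f : Fin I × Fin J → α)
    (hf : Function.Injective f) (hS : ∀ q, f q ∈ S) : ((I * J : ℕ) : ℕ∞) ≤ S.encard := by
  calc ((I * J : ℕ) : ℕ∞) = ENat.card (Fin I × Fin J) := by simp
    _ = (range f).encard := by rw [← image_univ, hf.encard_image, encard_univ]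
    _ ≤ S.encard := encard_le_encard (range_subset_iff.2 hS)

section Grid

variable {ι : Type*} {s : ι → Plane} {ρ : ι → ℝ} {A P : ℕ → ι} {I J : ℕ} {x ε y t r Y : ℝ}

theorem eq_of_mem_notchRegion_grid {i i' j j' : ℕ}
    (h : IsNotch s ρ (A i) (P j) (P (j + 1)) (x + i * ε) ε (y + j * t) t r Y)
    (hmem : IsNotch.center (x + i * ε) (y + j * t) t ∈
      notchRegion (x + i' * ε) ε (y + j' * t) t r) : i = i' ∧ j = j' := by
  have hε := h.ε_pos
  have ht := h.t_pos
  obtain ⟨h1, ⟨h2, h3⟩, -⟩ := hmem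
  simp only [IsNotch.center, Matrix.cons_val_zero, Matrix.cons_val_one,
    Matrix.cons_val_fin_one] at h1 h2 h3
  have h1 := abs_le.1 h1
  exact ⟨Nat.eq_of_mul_lt_mul hε (by linarith) (by linarith),
    Nat.eq_of_mul_lt_mul ht (by linarith) (by linarith)⟩

theorem mul_le_encard_cellFaces
    (hN : ∀ i ≤ I, ∀ j < J,
      IsNotch s ρ (A i) (P j) (P (j + 1)) (x + i * ε) ε (y + j * t) t r Y) :
    ((I * J : ℕ) : ℕ∞) ≤ (cellFaces (radiiDiagram s ρ)).encard := by
  refine Set.mul_le_encard_of_injective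
    (fun q => notchRegion (x + (q.1 : ℕ) * ε) ε (y + (q.2 : ℕ) * t) t r) ?_ ?_
  · rintro ⟨i, j⟩ ⟨i', j'⟩ heq
    have h := hN i i.2.le j j.2
    have := eq_of_mem_notchRegion_grid h (heq.subset h.center_mem)
    exact Prod.ext (Fin.ext this.1) (Fin.ext this.2)
  · rintro ⟨i, j⟩
    exact ⟨_, (hN i i.2.le j j.2).notchRegion_mem_componentsOf⟩

/-- The grid has one strip more than is counted (`i ≤ I`), so that every counted notch has a right
neighbor to share a segment with. -/
theorem isNotch_succ
    (hN : ∀ i ≤ I, ∀ j < J,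
      IsNotch s ρ (A i) (P j) (P (j + 1)) (x + i * ε) ε (y + j * t) t r Y) {i j : ℕ} (hi : i < I)
    (hj : j < J) : IsNotch s ρ (A (i + 1)) (P j) (P (j + 1)) (x + i * ε + ε) ε (y + j * t) t r Y := by
  have := hN (i + 1) hi j hj
  rwa [Nat.cast_add_one, add_one_mul, ← add_assoc] at this

theorem mul_le_encard_edges
    (hN : ∀ i ≤ I, ∀ j < J,
      IsNotch s ρ (A i) (P j) (P (j + 1)) (x + i * ε) ε (y + j * t) t r Y) :
    ((I * J : ℕ) : ℕ∞) ≤ (edges (radiiDiagram s ρ)).encard := by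
  refine Set.mul_le_encard_of_injective
    (fun q => segment ℝ (IsNotch.corner (x + (q.1 : ℕ) * ε) ε (y + (q.2 : ℕ) * t) r)
      (IsNotch.corner' (x + (q.1 : ℕ) * ε) ε (y + (q.2 : ℕ) * t) t r)) ?_ ?_
  · rintro ⟨i, j⟩ ⟨i', j'⟩ heq
    have h := hN i i.2.le j j.2
    have h' := hN i' i'.2.le j' j'.2
    have hmem := heq.subset (left_mem_segment ℝ _ _)
    simp only [← h'.inter_eq_segment] at hmem
    obtain ⟨⟨h1, ⟨h2, h3⟩, -⟩, h4, -⟩ := hmem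
    have hε := h.ε_pos
    have hu : |x + (i : ℕ) * ε + ε / 2 - (x + (i : ℕ) * ε)| ≤ ε := by
      rw [add_sub_cancel_left, abs_of_pos (half_pos hε)]; linarith
    have e1 := h.sqrt_lt hu
    have e2 := h.sqrt_pos hu
    simp only [IsNotch.corner, Matrix.cons_val_zero, Matrix.cons_val_one,
      Matrix.cons_val_fin_one] at h1 h2 h3 h4
    have h1 := abs_le.1 h1
    have h4 := abs_le.1 h4
    exact Prod.ext (Fin.ext (Nat.eq_of_mul_lt_mul hε (by linarith) (by linarith)))
      (Fin.ext (Nat.eq_of_mul_lt_mul h.t_pos (by linarith) (by linarith)))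
  · rintro ⟨i, j⟩
    exact Or.inl ((hN i i.2.le j j.2).segment_mem_straightEdges (isNotch_succ hN i.2 j.2))

theorem mul_le_encard_vertices
    (hN : ∀ i ≤ I, ∀ j < J,
      IsNotch s ρ (A i) (P j) (P (j + 1)) (x + i * ε) ε (y + j * t) t r Y) :
    ((I * J : ℕ) : ℕ∞) ≤ (vertices (radiiDiagram s ρ)).encard := by
  refine Set.mul_le_encard_of_injective
    (fun q => IsNotch.corner (x + (q.1 : ℕ) * ε) ε (y + (q.2 : ℕ) * t) r) ?_ ?_
  · rintro ⟨i, j⟩ ⟨i', j'⟩ heq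
    have h := hN i i.2.le j j.2
    have hε := h.ε_pos
    have h0 := congrArg (fun p : Plane => p 0) heq
    have h1 := congrArg (fun p : Plane => p 1) heq
    simp only [IsNotch.corner, Matrix.cons_val_zero, Matrix.cons_val_one,
      Matrix.cons_val_fin_one] at h0 h1
    have hi : (i : ℕ) = i' := Nat.eq_of_mul_lt_mul hε (by linarith) (by linarith)
    rw [hi] at h1
    exact Prod.ext (Fin.ext hi)
      (Fin.ext (Nat.eq_of_mul_lt_mul h.t_pos (by linarith [h.t_pos]) (by linarith [h.t_pos])))
  · rintro ⟨i, j⟩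
    exact (hN i i.2.le j j.2).corner_mem_vertices (isNotch_succ hN i.2 j.2)

end Grid

/-! ### Areas of discs truncated to strips -/

theorem Plane.volume_prod {S S' : Set ℝ} (hS : MeasurableSet S) (hS' : MeasurableSet S') :
    volume {p : Plane | p 0 ∈ S ∧ p 1 ∈ S'} = volume S * volume S' := by
  have h1 : {p : Plane | p 0 ∈ S ∧ p 1 ∈ S'} =
      (@WithLp.ofLp 2 (Fin 2 → ℝ)) ⁻¹' (Set.pi univ ![S, S']) := by
    ext p; simp [Fin.forall_fin_two]
  rw [h1, (PiLp.volume_preserving_ofLp (Fin 2)).measure_preimage, volume_pi_pi, Fin.prod_univ_two]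
  · rfl
  · refine (MeasurableSet.univ_pi fun i => ?_).nullMeasurableSet
    fin_cases i
    · exact hS
    · exact hS'

/-- The part within distance `ρ` of `z` of the horizontal strip of width `t` centered at `z`. -/
def capStrip (z : Plane) (t ρ : ℝ) : Set Plane := {p | |p 1 - z 1| < t / 2 ∧ dist p z < ρ}

theorem isOpen_capStrip (z : Plane) (t ρ : ℝ) : IsOpen (capStrip z t ρ) := by
  have : capStrip z t ρ = {p | |p 1 - z 1| < t / 2} ∩ {p | dist p z < ρ} := rfl
  rw [this]
  exact (isOpen_lt (by fun_prop) (by fun_prop)).inter (isOpen_lt (by fun_prop) (by fun_prop))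

theorem volume_capStrip (z : Plane) (t ρ : ℝ) :
    volume (capStrip z t ρ) = volume (capStrip 0 t ρ) := by
  have : capStrip z t ρ = (fun p => p + -z) ⁻¹' capStrip 0 t ρ := by
    ext p
    simp [capStrip, dist_eq_norm, sub_eq_add_neg]
  rw [this, measure_preimage_add_right]

theorem volume_capStrip_lt (z : Plane) {t ρ r : ℝ} (ht : 0 < t) (hr : 0 < r) (hρ : ρ < r) :
    volume (capStrip z t ρ) < volume (capStrip z t r) := by
  set O : Set Plane := {p | |p 1 - z 1| < t / 2} ∩ ({p | max ρ 0 < dist p z} ∩ {p | dist p z < r})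
  have hO : IsOpen O := (isOpen_lt (by fun_prop) (by fun_prop)).inter
    ((isOpen_lt (by fun_prop) (by fun_prop)).inter (isOpen_lt (by fun_prop) (by fun_prop)))
  have hmax : max ρ 0 < r := max_lt hρ hr
  have hmax0 : 0 ≤ max ρ 0 := le_max_right _ _
  have hne : O.Nonempty := by
    refine ⟨!₂[z 0 + (max ρ 0 + r) / 2, z 1], ?_, ?_, ?_⟩
    · simp [ht]
    · rw [mem_ofPred_eq, Plane.lt_dist_iff (le_max_right _ _)]
      simp
      gcongr; linarith
    · rw [mem_ofPred_eq, Plane.dist_lt_iff hr.le]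
      simp
      gcongr; linarith
  have hdisj : Disjoint (capStrip z t ρ) O := by
    rw [Set.disjoint_left]
    rintro p ⟨-, h1⟩ ⟨-, h2, -⟩
    exact absurd ((le_max_left _ _).trans_lt h2) (not_lt.2 h1.le)
  have hsub : capStrip z t ρ ∪ O ⊆ capStrip z t r := by
    rintro p (⟨h1, h2⟩ | ⟨h1, h2, h3⟩)
    · exact ⟨h1, h2.trans hρ⟩
    · exact ⟨h1, h3⟩
  have hfin : volume (capStrip z t ρ) ≠ ∞ :=
    ((measure_mono fun p hp => hp.2).trans_lt (measure_ball_lt_top (x := z) (r := ρ))).ne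
  calc volume (capStrip z t ρ) < volume (capStrip z t ρ) + volume O :=
        ENNReal.lt_add_right hfin (hO.measure_pos _ hne).ne'
    _ = volume (capStrip z t ρ ∪ O) := (measure_union hdisj hO.measurableSet).symm
    _ ≤ _ := measure_mono hsub

theorem volume_capStrip_le (t : ℝ) {r : ℝ} (hr : 0 ≤ r) :
    volume (capStrip 0 t r) ≤ ENNReal.ofReal (2 * r * t) := by
  calc volume (capStrip 0 t r)
      ≤ volume {p : Plane | p 0 ∈ Ioo (-r) r ∧ p 1 ∈ Ioo (-(t / 2)) (t / 2)} := by
        refine measure_mono ?_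
        rintro p ⟨h1, h2⟩
        rw [Plane.dist_lt_iff hr] at h2
        simp only [PiLp.zero_apply, sub_zero] at h1 h2
        exact ⟨abs_lt.1 (abs_lt_of_sq_lt_sq (by nlinarith) hr), abs_lt.1 h1⟩
    _ = ENNReal.ofReal (2 * r * t) := by
        rw [Plane.volume_prod measurableSet_Ioo measurableSet_Ioo, Real.volume_Ioo,
          Real.volume_Ioo, ← ENNReal.ofReal_mul (by linarith)]
        congr 1; ring

theorem le_volume_capStrip {t r : ℝ} (hr : 0 ≤ r) (htr : t ≤ r) :
    ENNReal.ofReal (3 / 2 * r * t) ≤ volume (capStrip 0 t r) := by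
  calc ENNReal.ofReal (3 / 2 * r * t)
      = volume {p : Plane | p 0 ∈ Ioo (-(3 / 4 * r)) (3 / 4 * r) ∧
          p 1 ∈ Ioo (-(t / 2)) (t / 2)} := by
        rw [Plane.volume_prod measurableSet_Ioo measurableSet_Ioo, Real.volume_Ioo,
          Real.volume_Ioo, ← ENNReal.ofReal_mul (by linarith)]
        congr 1; ring
    _ ≤ volume (capStrip 0 t r) := by
        refine measure_mono ?_
        rintro p ⟨⟨h1, h2⟩, h3, h4⟩
        refine ⟨by simpa using abs_lt.2 ⟨h3, h4⟩, ?_⟩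
        rw [Plane.dist_lt_iff hr]
        simp only [PiLp.zero_apply, sub_zero]
        -- The corner of the rectangle is inside the disc: `(3/4)² + (1/2)² < 1`, as `t ≤ r`.
        nlinarith

theorem continuous_volume_capStrip (r : ℝ) :
    Continuous fun t => volume (capStrip 0 t r) := by
  refine continuous_iff_continuousAt.2 fun t => ?_
  refine tendsto_measure_of_ae_tendsto_indicator (B := ball 0 r) _
    (isOpen_capStrip 0 t r).measurableSet (fun t' => (isOpen_capStrip 0 t' r).measurableSet)
    measurableSet_ball measure_ball_lt_top.ne (Eventually.of_forall fun t' p hp => hp.2) ?_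
  have h0 : volume {p : Plane | p 0 ∈ univ ∧ p 1 ∈ ({t / 2, -(t / 2)} : Set ℝ)} = 0 := by
    rw [Plane.volume_prod MeasurableSet.univ (Set.toFinite _).measurableSet,
      (Set.toFinite {t / 2, -(t / 2)}).measure_zero, mul_zero]
  filter_upwards [compl_mem_ae_iff.2 h0] with p hp
  have hne : |p 1| ≠ t / 2 := fun h => hp ⟨trivial, by
    rcases abs_choice (p 1) with h' | h'
    · left; linarith
    · right; rw [mem_singleton_iff]; linarith⟩
  have hc : ContinuousAt (fun t' : ℝ => t' / 2) t := by fun_prop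
  rcases lt_or_gt_of_ne hne with h | h
  · filter_upwards [continuousAt_const.eventually_lt hc h] with t' h'
    simp [capStrip, h, h']
  · filter_upwards [hc.eventually_lt continuousAt_const h] with t' h'
    simp [capStrip, h.not_gt, h'.not_gt]

/-- Intermediate value theorem in the width: the area is `0` at width `0` and at least `3/2 * r²` at
width `r`. The two inequalities come from rectangles around and inside the truncated disc. -/
theorem exists_capStrip {r a : ℝ} (hr : 0 < r) (ha : 0 < a) (har : a ≤ r ^ 2) :
    ∃ t, 0 < t ∧ t ≤ r ∧ volume (capStrip 0 t r) = ENNReal.ofReal a ∧ a ≤ 2 * r * t ∧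
      3 / 2 * r * t ≤ a := by
  have h1 : ENNReal.ofReal a ∈ Icc (volume (capStrip 0 0 r)) (volume (capStrip 0 r r)) := by
    refine ⟨(volume_capStrip_le 0 hr.le).trans (by simp), ?_⟩
    refine le_trans ?_ (le_volume_capStrip hr.le le_rfl)
    exact ENNReal.ofReal_le_ofReal (by nlinarith)
  obtain ⟨t, ⟨ht0, htr⟩, ht⟩ :=
    intermediate_value_Icc hr.le (continuous_volume_capStrip r).continuousOn h1
  simp only at ht
  have h2 := volume_capStrip_le t hr.le
  have h3 := le_volume_capStrip hr.le htr
  rw [ht, ENNReal.ofReal_le_ofReal_iff (by positivity)] at h2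
  rw [ht, ENNReal.ofReal_le_ofReal_iff ha.le] at h3
  exact ⟨t, lt_of_le_of_ne ht0 (fun h => by rw [← h, mul_zero] at h2; linarith), htr, ht, h2, h3⟩

/-! ### The column: radii of its inner sites -/

section Column

variable {ι : Type*} {s : ι → Plane} {ρ : ι → ℝ} {a r t η : ℝ}

theorem capStrip_subset_cellCore {i : ι} (hi : s i 0 = 0)
    (h : ∀ j, j ≠ i → s j 0 = 0 ∧ t ≤ |s j 1 - s i 1|) :
    capStrip (s i) t (ρ i) ⊆ cellCore s ρ i := by
  rintro p ⟨h1, h2⟩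
  refine ⟨h2, fun j hj => Or.inr ?_⟩
  obtain ⟨h3, h4⟩ := h j hj
  rw [Plane.dist_lt_dist_iff, hi, h3, add_lt_add_iff_left, sq_lt_sq]
  have := abs_sub_abs_le_abs_sub (s j 1 - s i 1) (p 1 - s i 1)
  rw [show s j 1 - s i 1 - (p 1 - s i 1) = -(p 1 - s j 1) by ring, abs_neg] at this
  linarith

/-- A neighbor with at least the same radius reaches every point of the cell that is no farther from
it, so the cell stays on its own side of the bisector. The sign `σ` treats both directions at once.
-/
theorem lt_of_mem_cellCore {i j : ι} {σ : ℝ} (hσ : σ ^ 2 = 1) (ht : 0 < t)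
    (hi : s i 0 = 0) (hj : s j 0 = 0) (hij : s j 1 = s i 1 - σ * t) (hρ : ρ i ≤ ρ j) {p : Plane}
    (hp : p ∈ cellCore s ρ i) : -(t / 2) < σ * (p 1 - s i 1) := by
  by_contra! hle
  have hne : j ≠ i := by
    rintro rfl
    have : σ * t = 0 := by linarith
    rcases mul_eq_zero.1 this with h | h
    · rw [h] at hσ; norm_num at hσ
    · exact ht.ne' h
  have h1 : dist p (s j) ≤ dist p (s i) := by
    rw [← not_lt, Plane.dist_lt_dist_iff, not_lt, hi, hj, hij]
    have : σ ^ 2 * t ^ 2 = t ^ 2 := by rw [hσ, one_mul]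
    nlinarith [mul_le_mul_of_nonneg_left hle ht.le]
  have := mem_cellCore_of_subset hp hne h1
  exact absurd hp.1 (not_lt.2 (by linarith))

theorem cellCore_subset_capStrip {i j k : ι} (ht : 0 < t) (hi : s i 0 = 0) (hj : s j 0 = 0)
    (hk : s k 0 = 0) (hij : s j 1 = s i 1 - t) (hik : s k 1 = s i 1 + t) (hρj : ρ i ≤ ρ j)
    (hρk : ρ i ≤ ρ k) : cellCore s ρ i ⊆ capStrip (s i) t (ρ i) := by
  intro p hp
  have h1 := lt_of_mem_cellCore (σ := 1) (by norm_num) ht hi hj (by linarith) hρj hp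
  have h2 := lt_of_mem_cellCore (σ := -1) (by norm_num) ht hi hk (by linarith) hρk hp
  exact ⟨abs_lt.2 ⟨by linarith, by linarith⟩, hp.1⟩

/-- The site `s i` at an end of a column has a large radius, because the many sites `s g` just
beyond it keep it from using the half plane at that end. -/
theorem le_radius_of_end [Finite ι] (ha : ∀ i, volume (cellCore s ρ i) = ENNReal.ofReal a)
    {i j : ι} {σ : ℝ} (hσ : σ = 1 ∨ σ = -1) (hr : 0 < r) (ht : 0 < t) (hη : 0 < η)
    (hi : s i 0 = 0) (hj : s j 0 = 0) (hij : s j 1 = s i 1 - σ * t) (hρ : ρ i ≤ ρ j)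
    (G : Finset ι) (hG0 : ∀ g ∈ G, s g 0 = 0)
    (hG : ∀ g ∈ G, 0 < σ * (s g 1 - s i 1) ∧ σ * (s g 1 - s i 1) ≤ η)
    (harea : 2 * r * (t / 2 + η) < a) (hcard : Real.pi * (r + η) ^ 2 < G.card * a) : r ≤ ρ i := by
  by_contra! hlt
  have hσ2 : σ ^ 2 = 1 := by rcases hσ with rfl | rfl <;> norm_num
  -- Otherwise the cell fits in a rectangle of width `2 * r` and height `t / 2 + η`, whose area is
  -- below `a`.
  obtain ⟨p, hp, hpη⟩ : ∃ p ∈ cellCore s ρ i, η < σ * (p 1 - s i 1) := by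
    by_contra! hall
    have hsub : cellCore s ρ i ⊆ {p : Plane | p 0 ∈ Ioo (-r) r ∧
        p 1 ∈ {v : ℝ | -(t / 2) ≤ σ * (v - s i 1) ∧ σ * (v - s i 1) ≤ η}} := by
      intro p hp
      have h1 := (hp.1.trans hlt)
      rw [Plane.dist_lt_iff hr.le, hi, sub_zero] at h1
      exact ⟨abs_lt.1 (abs_lt_of_sq_lt_sq (by nlinarith) hr.le),
        (lt_of_mem_cellCore hσ2 ht hi hj hij hρ hp).le, hall p hp⟩
    have hset : ∃ u, {v : ℝ | -(t / 2) ≤ σ * (v - s i 1) ∧ σ * (v - s i 1) ≤ η} =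
        Icc u (u + (t / 2 + η)) := by
      rcases hσ with rfl | rfl
      · refine ⟨s i 1 - t / 2, ?_⟩
        ext v; simp only [mem_ofPred_eq, mem_Icc]
        constructor <;> rintro ⟨h1, h2⟩ <;> constructor <;> linarith
      · refine ⟨s i 1 - η, ?_⟩
        ext v; simp only [mem_ofPred_eq, mem_Icc]
        constructor <;> rintro ⟨h1, h2⟩ <;> constructor <;> linarith
    obtain ⟨u, hu⟩ := hset
    rw [hu] at hsub
    have := measure_mono (μ := volume) hsub
    rw [ha, Plane.volume_prod measurableSet_Ioo measurableSet_Icc, Real.volume_Ioo,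
      Real.volume_Icc, ← ENNReal.ofReal_mul (by linarith),
      ENNReal.ofReal_le_ofReal_iff (by nlinarith)] at this
    nlinarith
  -- Every cluster site is closer to `p` but does not own it, so its radius is less than the
  -- distance from `p` to `s i`.
  have hGρ : ∀ g ∈ G, ρ g ≤ r := by
    intro g hg
    obtain ⟨h1, h2⟩ := hG g hg
    have hlt' : dist p (s g) < dist p (s i) := by
      rw [Plane.dist_lt_dist_iff, hi, hG0 g hg, add_lt_add_iff_left]
      have e : ∀ q q' : ℝ, (q - q') ^ 2 = (σ * (q - q')) ^ 2 := fun q q' => by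
        rw [mul_pow, hσ2, one_mul]
      rw [e, e (p 1)]
      have : σ * (p 1 - s g 1) = σ * (p 1 - s i 1) - σ * (s g 1 - s i 1) := by ring
      rw [this]
      nlinarith
    have hne : g ≠ i := fun h => by rw [h] at hlt'; exact lt_irrefl _ hlt'
    linarith [mem_cellCore_of_subset hp hne hlt'.le, hp.1]
  have := card_mul_le_of_radii_le le_rfl ha G (z := s i) (D := r) (η := η)
    (by linarith) hGρ (by
      intro g hg
      obtain ⟨h1, h2⟩ := hG g hg
      rw [Plane.dist_le_iff hη.le, hG0 g hg, hi]
      have : (s g 1 - s i 1) ^ 2 = (σ * (s g 1 - s i 1)) ^ 2 := by rw [mul_pow, hσ2, one_mul]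
      rw [this]
      nlinarith)
  linarith

end Column

/-- The indices of the sites of a column: two clusters of `K` sites at the ends of a progression
of `m + 1` sites. -/
abbrev ColumnIndex (m K : ℕ) : Type := Fin (m + 1) ⊕ (Fin K ⊕ Fin K)

/-- The ordinates of the sites of a column. -/
def columnHeight (m K : ℕ) (t e : ℝ) : ColumnIndex m K → ℝ
  | .inl k => k * t
  | .inr (.inl g) => -((g + 1) * e)
  | .inr (.inr g) => m * t + (g + 1) * e

/-- The sites of a column. -/
noncomputable def columnSite (m K : ℕ) (t e : ℝ) (i : ColumnIndex m K) : Plane :=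
  !₂[0, columnHeight m K t e i]

section

variable {m K : ℕ} {t e : ℝ}

theorem columnSite_zero (i : ColumnIndex m K) : columnSite m K t e i 0 = 0 := rfl

theorem columnSite_one (i : ColumnIndex m K) : columnSite m K t e i 1 = columnHeight m K t e i :=
  rfl

theorem columnHeight_mem (ht : 0 < t) (he : 0 < e) (i : ColumnIndex m K) :
    columnHeight m K t e i ∈ Icc (-(K * e)) (m * t + K * e) := by
  have hK : 0 ≤ K * e := by positivity
  have hm : 0 ≤ m * t := by positivity
  rcases i with k | g | g
  · have : (k : ℝ) ≤ m := by exact_mod_cast Nat.lt_succ_iff.1 k.2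
    have : (k : ℝ) * t ≤ m * t := by gcongr
    have : 0 ≤ (k : ℝ) * t := by positivity
    exact ⟨by simp only [columnHeight]; linarith, by simp only [columnHeight]; linarith⟩
  all_goals
    have : (g : ℝ) + 1 ≤ K := by exact_mod_cast g.2
    have : ((g : ℝ) + 1) * e ≤ K * e := by gcongr
    have : 0 ≤ ((g : ℝ) + 1) * e := by positivity
    exact ⟨by simp only [columnHeight]; linarith, by simp only [columnHeight]; linarith⟩

theorem injective_columnSite (ht : 0 < t) (he : 0 < e) :
    Function.Injective (columnSite m K t e) := by
  intro i j h
  have h1 : columnHeight m K t e i = columnHeight m K t e j := congrArg (fun p : Plane => p 1) h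
  have hk : ∀ k : Fin (m + 1), (0 : ℝ) ≤ k * t ∧ k * t ≤ m * t := fun k =>
    ⟨by positivity, by gcongr; exact_mod_cast Nat.lt_succ_iff.1 k.2⟩
  have hg : ∀ g : Fin K, 0 < ((g : ℝ) + 1) * e := fun g => by positivity
  have hm : 0 ≤ m * t := by positivity
  rcases i with k | g | g <;> rcases j with k' | g' | g' <;> simp only [columnHeight] at h1
  · have := mul_right_cancel₀ ht.ne' h1
    norm_cast at this
    rw [Fin.ext this]
  · linarith [hk k, hg g']
  · linarith [hk k, hg g']
  · linarith [hk k', hg g]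
  · have := mul_right_cancel₀ he.ne' (neg_injective h1)
    norm_cast at this
    rw [Fin.ext (Nat.succ_injective this)]
  · linarith [hg g, hg g']
  · linarith [hk k', hg g]
  · linarith [hg g, hg g']
  · have := mul_right_cancel₀ he.ne' (add_left_cancel h1)
    norm_cast at this
    rw [Fin.ext (Nat.succ_injective this)]

theorem le_abs_columnHeight_sub (ht : 0 < t) (he : 0 < e) {k : Fin (m + 1)} (hk0 : 0 < (k : ℕ))
    (hkm : (k : ℕ) < m) {j : ColumnIndex m K} (hj : j ≠ .inl k) :
    t ≤ |columnHeight m K t e j - columnHeight m K t e (.inl k)| := by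
  have h1 : t ≤ k * t := le_mul_of_one_le_left ht.le (by exact_mod_cast hk0)
  have h2 : ((k : ℕ) : ℝ) * t + t ≤ m * t := by
    rw [← add_one_mul]; gcongr; exact_mod_cast hkm
  rcases j with k' | g | g <;> simp only [columnHeight]
  · have hne : (k' : ℕ) ≠ k := fun h => hj (by rw [Fin.ext h])
    rw [← sub_mul, abs_mul, abs_of_pos ht]
    refine le_mul_of_one_le_left ht.le ?_
    rcases lt_or_gt_of_ne hne with h | h
    · rw [abs_sub_comm]
      refine le_trans ?_ (le_abs_self _)
      have : ((k' : ℕ) : ℝ) + 1 ≤ k := by exact_mod_cast h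
      linarith
    · refine le_trans ?_ (le_abs_self _)
      have : ((k : ℕ) : ℝ) + 1 ≤ k' := by exact_mod_cast h
      linarith
  · have : 0 ≤ ((g : ℝ) + 1) * e := by positivity
    rw [abs_sub_comm]
    exact le_trans (by linarith) (le_abs_self _)
  · have : 0 ≤ ((g : ℝ) + 1) * e := by positivity
    exact le_trans (by linarith) (le_abs_self _)

/-- The radii of the inner sites of the progression of a column. -/
theorem radius_eq_of_column {a r : ℝ} {ρ : ColumnIndex m K → ℝ} (hm : 0 < m)
    (ha : ∀ i, volume (cellCore (columnSite m K t e) ρ i) = ENNReal.ofReal a)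
    (hr : 0 < r) (ht : 0 < t) (he : 0 < e) (hK : 0 < K)
    (hcap : volume (capStrip 0 t r) = ENNReal.ofReal a)
    (harea : 2 * r * (t / 2 + K * e) < a) (hcard : Real.pi * (r + K * e) ^ 2 < K * a)
    {k : Fin (m + 1)} (hk0 : 0 < (k : ℕ)) (hkm : (k : ℕ) < m) : ρ (.inl k) = r := by
  have hη : 0 < K * e := by positivity
  -- It suffices to treat the site of the progression with the least radius: its neighbors then
  -- confine its cell. At an end, the cluster beyond it replaces the missing neighbor.
  have hge : ∀ k : Fin (m + 1), r ≤ ρ (.inl k) := by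
    obtain ⟨l, -, hmin⟩ := Finset.exists_min_image Finset.univ
      (fun k : Fin (m + 1) => ρ (.inl k)) Finset.univ_nonempty
    suffices r ≤ ρ (.inl l) from fun k => this.trans (hmin k (Finset.mem_univ k))
    rcases Nat.eq_zero_or_pos (l : ℕ) with hl0 | hl0
    · refine le_radius_of_end ha (σ := -1) (Or.inr rfl) hr ht hη (columnSite_zero _)
        (columnSite_zero (.inl ⟨1, by omega⟩)) ?_ (hmin _ (Finset.mem_univ _))
        (Finset.univ.map ⟨fun g : Fin K => .inr (.inl g), fun _ _ h => by simpa using h⟩) ?_ ?_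
        harea ?_
      · simp [columnSite_one, columnHeight, hl0]
      · exact fun _ _ => columnSite_zero _
      · intro g hg
        obtain ⟨g, -, rfl⟩ := Finset.mem_map.1 hg
        have : (g : ℝ) + 1 ≤ K := by exact_mod_cast g.2
        have : ((g : ℝ) + 1) * e ≤ K * e := by gcongr
        have : 0 < ((g : ℝ) + 1) * e := by positivity
        change 0 < -1 * (-(((g : ℝ) + 1) * e) - ((l : ℕ) : ℝ) * t) ∧
          -1 * (-(((g : ℝ) + 1) * e) - ((l : ℕ) : ℝ) * t) ≤ K * e
        rw [hl0]
        constructor <;> push_cast <;> linarith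
      · simpa using hcard
    · rcases Nat.lt_or_ge (l : ℕ) m with hlm | hlm
      · by_contra! hlt
        have hsub := cellCore_subset_capStrip (s := columnSite m K t e) (ρ := ρ) (i := .inl l)
          (j := .inl ⟨l - 1, by omega⟩) (k := .inl ⟨l + 1, by omega⟩) ht (columnSite_zero _)
          (columnSite_zero _) (columnSite_zero _)
          (by simp [columnSite_one, columnHeight, Nat.cast_sub hl0, sub_mul])
          (by simp [columnSite_one, columnHeight, add_mul])
          (hmin _ (Finset.mem_univ _)) (hmin _ (Finset.mem_univ _))
        have h1 := (measure_mono hsub).trans_lt (volume_capStrip_lt _ ht hr hlt)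
        rw [ha, volume_capStrip, hcap] at h1
        exact lt_irrefl _ h1
      · have hlm : (l : ℕ) = m := le_antisymm (Nat.lt_succ_iff.1 l.2) hlm
        refine le_radius_of_end ha (σ := 1) (Or.inl rfl) hr ht hη (columnSite_zero _)
          (columnSite_zero (.inl ⟨m - 1, by omega⟩)) ?_ (hmin _ (Finset.mem_univ _))
          (Finset.univ.map ⟨fun g : Fin K => .inr (.inr g), fun _ _ h => by simpa using h⟩) ?_ ?_
          harea ?_
        · simp [columnSite_one, columnHeight, hlm, Nat.cast_sub (show 1 ≤ m from hm), sub_mul]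
        · exact fun _ _ => columnSite_zero _
        · intro g hg
          obtain ⟨g, -, rfl⟩ := Finset.mem_map.1 hg
          have : (g : ℝ) + 1 ≤ K := by exact_mod_cast g.2
          have : ((g : ℝ) + 1) * e ≤ K * e := by gcongr
          have : 0 < ((g : ℝ) + 1) * e := by positivity
          change 0 < 1 * (m * t + ((g : ℝ) + 1) * e - ((l : ℕ) : ℝ) * t) ∧
            1 * (m * t + ((g : ℝ) + 1) * e - ((l : ℕ) : ℝ) * t) ≤ K * e
          rw [hlm]
          constructor <;> linarith
        · simpa using hcard
  -- Conversely, an inner site always owns its disc within its strip, so a radius above `r` gives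
  -- too much area.
  refine le_antisymm (not_lt.1 fun hlt => ?_) (hge k)
  have hsub := capStrip_subset_cellCore (s := columnSite m K t e) (ρ := ρ) (i := .inl k)
    (t := t) (columnSite_zero _)
    fun j hj => ⟨columnSite_zero _, le_abs_columnHeight_sub ht he hk0 hkm hj⟩
  have h1 := (volume_capStrip_lt (columnSite m K t e (.inl k)) ht (hr.trans hlt) hlt).trans_le
    (measure_mono hsub)
  rw [ha, volume_capStrip, hcap] at h1
  exact lt_irrefl _ h1

end

/-! ### The row: large radii of its middle sites -/

/-- The sites of a row. -/
noncomputable def rowSite (q : ℕ) (x ε Y : ℝ) (i : Fin q) : Plane := !₂[x + i * ε, Y]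

section Row

variable {q : ℕ} {x ε Y : ℝ}

theorem rowSite_zero (i : Fin q) : rowSite q x ε Y i 0 = x + i * ε := rfl

theorem rowSite_one (i : Fin q) : rowSite q x ε Y i 1 = Y := rfl

theorem injective_rowSite (hε : 0 < ε) : Function.Injective (rowSite q x ε Y) := by
  intro i j h
  have h1 : x + i * ε = x + j * ε := congrArg (fun p : Plane => p 0) h
  have := mul_right_cancel₀ hε.ne' (add_left_cancel h1)
  exact Fin.ext (by exact_mod_cast this)

/-- The sites of a short row with many sites on both sides have large radii. -/
theorem le_radius_of_row {μ : Measure Plane} (hμ : μ ≤ volume) {ρ : Fin q → ℝ} {a D : ℝ} {M : ℕ}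
    (ha : ∀ i, μ (cellCore (rowSite q x ε Y) ρ i) = ENNReal.ofReal a) (ha0 : 0 < a)
    (hε : 0 < ε) (hD : 0 < D) (harea : 2 * (q * ε) * (2 * D) < a)
    (hcard : Real.pi * (D + q * ε) ^ 2 < M * a) {i : Fin q} (hMi : M ≤ i) (hiM : i + M < q) :
    D ≤ ρ i := by
  by_contra! hlt
  have hq : 0 ≤ q * ε := by positivity
  -- Otherwise the cell fits in a box of area below `a`. As the row has width at most `q * ε`, all
  -- sites on the side of `p` are closer to `p` than site `i`.
  obtain ⟨p, hp, hpq⟩ : ∃ p ∈ cellCore (rowSite q x ε Y) ρ i,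
      q * ε < |p 0 - (x + i * ε)| := by
    by_contra! hall
    have hsub : cellCore (rowSite q x ε Y) ρ i ⊆ {p : Plane |
        p 0 ∈ Icc (x + i * ε - q * ε) (x + i * ε + q * ε) ∧ p 1 ∈ Ioo (Y - D) (Y + D)} := by
      intro p hp
      have h1 := (hp.1.trans hlt)
      rw [Plane.dist_lt_iff hD.le, rowSite_one] at h1
      have h2 := abs_le.1 (hall p hp)
      have h3 := abs_lt.1 (abs_lt_of_sq_lt_sq (a := p 1 - Y) (b := D)
        (by linarith [sq_nonneg (p 0 - rowSite q x ε Y i 0)]) hD.le)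
      exact ⟨⟨by linarith, by linarith⟩, ⟨by linarith, by linarith⟩⟩
    have := (measure_mono hsub).trans (hμ _)
    rw [ha, Plane.volume_prod measurableSet_Icc measurableSet_Ioo, Real.volume_Ioo,
      Real.volume_Icc, ← ENNReal.ofReal_mul (by linarith),
      ENNReal.ofReal_le_ofReal_iff (by ring_nf; positivity)] at this
    linarith
  have hx : ∀ g : Fin q, |((g : ℕ) : ℝ) * ε - (i : ℕ) * ε| ≤ q * ε := by
    intro g
    rw [← sub_mul, abs_mul, abs_of_pos hε]
    refine mul_le_mul_of_nonneg_right (abs_le.2 ⟨?_, ?_⟩) hε.le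
    · have : ((i : ℕ) : ℝ) ≤ q := by exact_mod_cast i.2.le
      have : (0 : ℝ) ≤ (g : ℕ) := Nat.cast_nonneg _
      linarith
    · have : ((g : ℕ) : ℝ) ≤ q := by exact_mod_cast g.2.le
      have : (0 : ℝ) ≤ (i : ℕ) := Nat.cast_nonneg _
      linarith
  have main : ∀ G : Finset (Fin q), M ≤ G.card → (∀ g ∈ G, |p 0 - (x + (g : ℕ) * ε)| <
      |p 0 - (x + (i : ℕ) * ε)|) → False := by
    intro G hM hG
    have hGρ : ∀ g ∈ G, ρ g ≤ D := by
      intro g hg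
      have hlt' : dist p (rowSite q x ε Y g) < dist p (rowSite q x ε Y i) := by
        rw [Plane.dist_lt_dist_iff, rowSite_one, rowSite_one, add_lt_add_iff_right, sq_lt_sq]
        exact hG g hg
      have hne : g ≠ i := fun h => by rw [h] at hlt'; exact lt_irrefl _ hlt'
      linarith [mem_cellCore_of_subset hp hne hlt'.le, hp.1]
    have := card_mul_le_of_radii_le hμ ha G (z := rowSite q x ε Y i) (D := D) (η := q * ε)
      (by linarith) hGρ (by
        intro g _
        rw [Plane.dist_le_iff hq, rowSite_one, rowSite_one, sub_self, rowSite_zero, rowSite_zero,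
          add_sub_add_left_eq_sub]
        have := sq_le_sq' (by linarith [(abs_le.1 (hx g)).1]) (abs_le.1 (hx g)).2
        linarith)
    have hMG : (M : ℝ) * a ≤ G.card * a := by gcongr
    linarith
  rcases lt_or_ge (p 0 - (x + i * ε)) 0 with hneg | hpos
  · refine main (Finset.Iio i) (by rw [Fin.card_Iio]; exact hMi) fun g hg => ?_
    have hgi : ((g : ℕ) : ℝ) * ε < (i : ℕ) * ε := by
      gcongr; exact_mod_cast Finset.mem_Iio.1 hg
    have := (abs_le.1 (hx g)).1
    rw [abs_of_neg hneg] at hpq ⊢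
    rw [abs_lt]
    constructor <;> linarith
  · refine main (Finset.Ioi i) (by rw [Fin.card_Ioi]; omega) fun g hg => ?_
    have hgi : ((i : ℕ) : ℝ) * ε < (g : ℕ) * ε := by
      gcongr; exact_mod_cast Finset.mem_Ioi.1 hg
    have := (abs_le.1 (hx g)).2
    rw [abs_of_nonneg hpos] at hpq ⊢
    rw [abs_lt]
    constructor <;> linarith

end Row

/-! ### Combining two families of sites, the first having priority -/

section Glue

variable {ι κ : Type*} {s₁ : ι → Plane} {s₂ : κ → Plane} {ρ₁ : ι → ℝ} {ρ₂ : κ → ℝ}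

theorem cellCore_elim_inl
    (hsep : ∀ i p, dist p (s₁ i) ≤ ρ₁ i → ∀ k, dist p (s₁ i) < dist p (s₂ k)) (i : ι) :
    cellCore (Sum.elim s₁ s₂) (Sum.elim ρ₁ ρ₂) (.inl i) = cellCore s₁ ρ₁ i := by
  ext p
  constructor
  · rintro ⟨h1, h2⟩
    exact ⟨h1, fun j hj => h2 (.inl j) (by simpa using hj)⟩
  · rintro ⟨h1, h2⟩
    refine ⟨h1, ?_⟩
    rintro (j | k) hj
    · exact h2 j (by simpa using hj)
    · exact Or.inr (hsep i p h1.le k)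

/-- Sites of the first family win wherever they reach, so the second family competes in their outer
region as if alone. -/
theorem cellCore_elim_inr
    (hsep : ∀ i p, dist p (s₁ i) ≤ ρ₁ i → ∀ k, dist p (s₁ i) < dist p (s₂ k)) (k : κ) :
    cellCore (Sum.elim s₁ s₂) (Sum.elim ρ₁ ρ₂) (.inr k) =
      cellCore s₂ ρ₂ k ∩ outerCore s₁ ρ₁ := by
  ext p
  constructor
  · rintro ⟨h1, h2⟩
    refine ⟨⟨h1, fun j hj => h2 (.inr j) (by simpa using hj)⟩, fun i => ?_⟩
    by_contra! hle
    rcases h2 (.inl i) (by simp) with h | h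
    · exact absurd hle (not_le.2 h)
    · exact lt_asymm h (hsep i p hle k)
  · rintro ⟨⟨h1, h2⟩, h3⟩
    refine ⟨h1, ?_⟩
    rintro (j | k') hj
    · exact Or.inl (h3 j)
    · exact h2 k' (by simpa using hj)

/-- The first family covers finite area, so the restricted measure is still infinite and the
existence result applies to it. The measure stays in the conclusion so that the row can later be
studied on its own. -/
theorem exists_radii_glue [Finite ι] [Finite κ] {a : ℝ} (hs₂ : Function.Injective s₂)
    (ha₁ : ∀ i, volume (cellCore s₁ ρ₁ i) = ENNReal.ofReal a)
    (hsep : ∀ i p, dist p (s₁ i) ≤ ρ₁ i → ∀ k, dist p (s₁ i) < dist p (s₂ k)) :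
    ∃ (μ : Measure Plane) (ρ₂ : κ → ℝ), μ ≤ volume ∧
      (∀ k, μ (cellCore s₂ ρ₂ k) = ENNReal.ofReal a) ∧
      ∀ o, volume (cellCore (Sum.elim s₁ s₂) (Sum.elim ρ₁ ρ₂) o) = ENNReal.ofReal a := by
  have hopen := isOpen_outerCore s₁ ρ₁
  have huniv : volume.restrict (outerCore s₁ ρ₁) univ = ∞ := by
    rw [Measure.restrict_apply_univ]
    have hfin : volume (outerCore s₁ ρ₁)ᶜ < ∞ := by
      have hsub : (outerCore s₁ ρ₁)ᶜ ⊆ ⋃ i, closedBall (s₁ i) (ρ₁ i) := by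
        intro p hp
        simp only [outerCore, mem_compl_iff, mem_ofPred_eq, not_forall, not_lt] at hp
        exact mem_iUnion.2 hp
      have := Fintype.ofFinite ι
      refine (measure_mono hsub).trans_lt ((measure_iUnion_fintype_le _ _).trans_lt ?_)
      exact ENNReal.sum_lt_top.2 fun i _ => measure_closedBall_lt_top
    by_contra hne
    have htop : volume (univ : Set Plane) = ∞ := by
      have : NoncompactSpace Plane := NormedSpace.noncompactSpace ℝ Plane
      exact measure_univ_of_isAddLeftInvariant _
    rw [← measure_add_measure_compl hopen.measurableSet] at htop
    exact (ENNReal.add_lt_top.2 ⟨lt_top_iff_ne_top.2 hne, hfin⟩).ne htop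
  obtain ⟨ρ₂, hρ₂⟩ := exists_radii hs₂ Measure.restrict_le_self huniv a
  refine ⟨_, ρ₂, Measure.restrict_le_self, hρ₂, ?_⟩
  rintro (i | k)
  · rw [cellCore_elim_inl hsep, ha₁]
  · rw [cellCore_elim_inr hsep, ← Measure.restrict_apply (isOpen_cellCore _ _ _).measurableSet, hρ₂]

end Glue

/-! ### Assembling column and row -/

theorem Plane.abs_le_dist (p q : Plane) : |p 1 - q 1| ≤ dist p q := by
  rw [← abs_of_nonneg (dist_nonneg (x := p) (y := q)), ← sq_le_sq, Plane.dist_sq]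
  nlinarith [sq_nonneg (p 0 - q 0)]

/-- A column and a row above it form notches. -/
theorem isNotch_column_row {m K q : ℕ} {t e r x ε Y R D : ℝ} {ρ₁ : ColumnIndex m K → ℝ}
    {ρ₂ : Fin q → ℝ} (ht : 0 < t) (he : 0 < e) (hr : 0 < r) (hε : 0 < ε)
    (hsep : ∀ i p, dist p (columnSite m K t e i) ≤ ρ₁ i →
      ∀ k, dist p (columnSite m K t e i) < dist p (rowSite q x ε Y k))
    (hρ₁ : ∀ k : Fin (m + 1), 0 < (k : ℕ) → (k : ℕ) < m → ρ₁ (.inl k) = r)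
    (hR0 : 0 ≤ R) (hR : ∀ i, ρ₁ i ≤ R)
    (hD : ∀ p : Plane, 0 ≤ p 0 → p 0 ≤ r → 0 ≤ p 1 → p 1 ≤ m * t →
      ∀ i, dist p (rowSite q x ε Y i) < D)
    {i i₁ i₂ : Fin q} (hi₁ : (i₁ : ℕ) + 1 = i) (hi₂ : (i : ℕ) + 1 = i₂)
    (hρi : D ≤ ρ₂ i) (hρi₁ : D ≤ ρ₂ i₁) (hρi₂ : D ≤ ρ₂ i₂)
    (hpos : 0 < x + i * ε - ε) (hlt : x + i * ε + ε < r)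
    (hgap : r ^ 2 < (x + i * ε - ε) ^ 2 + (t / 2) ^ 2)
    {k l : Fin (m + 1)} (hkl : (l : ℕ) = k + 1) (hk : R < k * t) (hkm : k * t + t + R < m * t) :
    IsNotch (Sum.elim (columnSite m K t e) (rowSite q x ε Y)) (Sum.elim ρ₁ ρ₂)
      (.inr i) (.inl (.inl k)) (.inl (.inl l)) (x + i * ε) ε (k * t) t r Y := by
  have hk0 : 0 < (k : ℕ) := by
    rcases Nat.eq_zero_or_pos (k : ℕ) with h | h
    · rw [h] at hk; push_cast at hk; linarith
    · exact h
  have hlm : (l : ℕ) < m := by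
    have h1 : ((l : ℕ) : ℝ) * t < m * t := by rw [hkl]; push_cast; linarith
    exact_mod_cast lt_of_mul_lt_mul_right h1 ht.le
  have hl0 : 0 < (l : ℕ) := by omega
  have hkm' : (k : ℕ) < m := by omega
  have hltm : ((l : ℕ) : ℝ) * t = k * t + t := by rw [hkl]; push_cast; ring
  have hbox : ∀ p ∈ notchBox (x + i * ε) ε (k * t) t,
      ∀ j, dist p (rowSite q x ε Y j) < D := by
    rintro p ⟨h1, h2, h3⟩
    have := abs_le.1 h1
    exact hD p (by linarith) (by linarith) (by linarith) (by linarith)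
  have hfar : ∀ p ∈ notchBox (x + i * ε) ε (k * t) t, ∀ j,
      columnHeight m K t e j ≤ 0 ∨ m * t ≤ columnHeight m K t e j →
      ρ₁ j < dist p (columnSite m K t e j) := by
    rintro p ⟨-, h2, h3⟩ j hj
    refine (hR j).trans_lt (lt_of_lt_of_le ?_ (Plane.abs_le_dist _ _))
    rw [columnSite_one]
    rcases hj with hj | hj
    · exact lt_of_lt_of_le (by linarith) (le_abs_self _)
    · exact lt_of_lt_of_le (by linarith) (neg_le_abs _)
  refine
    { ε_pos := hε
      t_pos := ht
      r_pos := hr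
      A_zero := rfl
      A_one := rfl
      P_zero := rfl
      P_one := rfl
      Q_zero := rfl
      Q_one := hltm
      radius_P := hρ₁ k hk0 hkm'
      radius_Q := hρ₁ l hl0 hlm
      pos := hpos
      lt := hlt
      gap := hgap
      reach := fun p hp => (hbox p hp i).trans_le hρi
      left := ⟨.inr i₁, ?_, rfl, fun p hp => (hbox p hp i₁).trans_le hρi₁⟩
      right := ⟨.inr i₂, ?_, rfl, fun p hp => (hbox p hp i₂).trans_le hρi₂⟩
      others := ?_
      prefer_P := fun p hp => hsep (.inl k) p (by rwa [hρ₁ k hk0 hkm']) i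
      prefer_Q := fun p hp => hsep (.inl l) p (by rwa [hρ₁ l hl0 hlm]) i
      strip := ?_ }
  · change x + ((i₁ : ℕ) : ℝ) * ε = _
    rw [← hi₁]; push_cast; ring
  · change x + ((i₂ : ℕ) : ℝ) * ε = _
    rw [← hi₂]; push_cast; ring
  · rintro ((j | g | g) | j) hA hP hQ
    · left
      rintro p hp
      change ρ₁ (.inl j) < dist p (columnSite m K t e (.inl j))
      rcases Nat.eq_zero_or_pos (j : ℕ) with hj0 | hj0
      · exact hfar p hp _ (Or.inl (by simp [columnHeight, hj0]))
      rcases Nat.lt_or_ge (j : ℕ) m with hjm | hjm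
      · have hjk : (j : ℕ) ≠ k := fun h => hP (by rw [Fin.ext h])
        have hjl : (j : ℕ) ≠ l := fun h => hQ (by rw [Fin.ext h])
        obtain ⟨h1, h2, h3⟩ := hp
        have h1 := abs_le.1 h1
        rw [hρ₁ j hj0 hjm, Plane.lt_dist_iff hr.le, columnSite_zero, columnSite_one, sub_zero]
        simp only [columnHeight]
        -- Any other inner column site is at least `t` away in height from the points of the box;
        -- half of that already suffices for `hgap`.
        have h4 : (t / 2) ^ 2 ≤ (p 1 - (j : ℕ) * t) ^ 2 := by
          rw [sq_le_sq, abs_of_pos (half_pos ht)]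
          rcases Nat.lt_or_ge (j : ℕ) k with h | h
          · have : ((j : ℕ) : ℝ) * t + t ≤ k * t := by
              rw [← add_one_mul]; gcongr; exact_mod_cast h
            exact le_trans (by linarith) (le_abs_self _)
          · have : ((l : ℕ) : ℝ) * t + t ≤ (j : ℕ) * t := by
              rw [← add_one_mul]; gcongr
              have : (l : ℕ) + 1 ≤ j := by omega
              exact_mod_cast this
            exact le_trans (by linarith) (neg_le_abs _)
        nlinarith
      · refine hfar p hp _ (Or.inr ?_)
        simp only [columnHeight]
        gcongr
    · left
      refine fun p hp => hfar p hp _ (Or.inl ?_)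
      simp only [columnHeight, neg_nonpos]
      positivity
    · left
      refine fun p hp => hfar p hp _ (Or.inr ?_)
      simp only [columnHeight, le_add_iff_nonneg_right]
      positivity
    · right
      refine ⟨rfl, ?_⟩
      change ε ≤ |x + ((j : ℕ) : ℝ) * ε - (x + (i : ℕ) * ε)|
      have hne : (j : ℕ) ≠ i := fun h => hA (by rw [Fin.ext h])
      rw [add_sub_add_left_eq_sub, ← sub_mul, abs_mul, abs_of_pos hε]
      refine le_mul_of_one_le_left hε.le ?_
      have : (1 : ℤ) ≤ |(j : ℤ) - (i : ℤ)| := Int.one_le_abs (by omega)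
      exact_mod_cast this
  · intro p hp1 hp2
    rw [cellCore_elim_inl hsep]
    refine capStrip_subset_cellCore (t := t) (columnSite_zero _)
      (fun j hj => ⟨columnSite_zero _, le_abs_columnHeight_sub ht he hk0 hkm' hj⟩) ⟨hp2, ?_⟩
    rw [hρ₁ k hk0 hkm']
    exact hp1

/-- A column of sites, with its stable radii. -/
theorem exists_column {h : ℕ} (hh : 0 < h) {a r : ℝ} (ha : 0 < a) (hr : 0 < r)
    (hra : r ^ 2 = h * a) :
    ∃ (t e : ℝ) (ρ : ColumnIndex (100 * h) (5 * h) → ℝ), 0 < t ∧ 0 < e ∧ r ≤ 2 * h * t ∧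
      3 * h * t ≤ 2 * r ∧ (5 * h : ℕ) * e ≤ r ∧
      (∀ i, volume (cellCore (columnSite (100 * h) (5 * h) t e) ρ i) = ENNReal.ofReal a) ∧
      (∀ k : Fin (100 * h + 1), 0 < (k : ℕ) → (k : ℕ) < 100 * h → ρ (.inl k) = r) ∧
      ∀ i, ρ i ≤ 7 * r := by
  have h1 : (1 : ℝ) ≤ h := by exact_mod_cast hh
  obtain ⟨t, ht, htr, hcap, hlow, hupp⟩ := exists_capStrip hr ha (by nlinarith)
  -- The cluster spacing `r / (60 * h²)` gives clusters of length `r / (12 * h)`. They add only `a /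
  -- 6` to `r * t ≤ 2 / 3 * a` in the area condition, and `3.15 * (13 / 12)² < 5` gives the
  -- cardinality condition.
  have e1 : (5 * h : ℕ) * (r / (60 * h ^ 2)) = r / (12 * h) := by
    push_cast; field_simp; norm_num
  have e2 : 2 * r * (r / (12 * h)) = a / 6 := by
    rw [show 2 * r * (r / (12 * h)) = r ^ 2 / (6 * h) by field_simp; norm_num, hra]
    field_simp
  have e3 : r / (12 * h) ≤ r / 12 := by
    gcongr; linarith
  have he : 0 < r / (60 * (h : ℝ) ^ 2) := by positivity
  have hinj := injective_columnSite (m := 100 * h) (K := 5 * h) ht he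
  obtain ⟨ρ, hρ⟩ := exists_radii hinj le_rfl
    (by
      have : NoncompactSpace Plane := NormedSpace.noncompactSpace ℝ Plane
      exact measure_univ_of_isAddLeftInvariant _) a
  have hta : ∀ c, c * a * h = c * r ^ 2 := fun c => by rw [hra]; ring
  refine ⟨t, _, ρ, ht, he, ?_, ?_, ?_, hρ, ?_, ?_⟩
  · have : r * r ≤ r * (2 * h * t) := by nlinarith
    exact le_of_mul_le_mul_left this hr
  · have : r * (3 * h * t) ≤ r * (2 * r) := by nlinarith
    exact le_of_mul_le_mul_left this hr
  · rw [e1]; linarith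
  · intro k hk0 hkm
    refine radius_eq_of_column (by omega) hρ hr ht he (by omega) hcap ?_ ?_ hk0 hkm
    · rw [e1, mul_add, e2]; linarith
    · rw [e1]
      have h2 : (r + r / (12 * h)) ^ 2 ≤ (r + r / 12) ^ 2 := by gcongr
      have h3 : Real.pi * (r + r / (12 * h)) ^ 2 ≤ 3.15 * (r + r / 12) ^ 2 := by
        gcongr; exact Real.pi_lt_d2.le
      push_cast
      nlinarith
  -- There are `110 * h + 1` sites, so the matched area is at most `111 * r²`, whereas `3 * 7² =
  -- 147`.
  · intro i
    by_contra! hlt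
    have h2 := pi_mul_sq_radius_le hinj ha.le hρ i (by linarith)
    simp only [Fintype.card_sum, Fintype.card_fin] at h2
    push_cast at h2
    have h3 : (7 * r) ^ 2 ≤ ρ i ^ 2 := by gcongr
    have h4 : 3 * (7 * r) ^ 2 ≤ Real.pi * ρ i ^ 2 := by
      gcongr; exact Real.pi_gt_three.le
    nlinarith

/-- Consecutive discs cross at abscissa `c < r`; all strips fit between `c` and `r` once `ε` is
small compared with `(r - c) / q`. -/
theorem exists_spacing {r t a D : ℝ} (q : ℕ) (hr : 0 < r) (ht : 0 < t) (ha : 0 < a) (hD : 0 < D) :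
    ∃ x ε : ℝ, 0 < ε ∧ 0 < x - ε ∧ r ^ 2 < (x - ε) ^ 2 + (t / 2) ^ 2 ∧
      x + q * ε + ε < r ∧ 2 * (q * ε) * (2 * D) < a := by
  set c := Real.sqrt (r ^ 2 - (t / 2) ^ 2) with hc
  have hcr : c < r := by
    rw [hc, Real.sqrt_lt' hr]; nlinarith
  have hc0 : 0 ≤ c := Real.sqrt_nonneg _
  have hcs : r ^ 2 - (t / 2) ^ 2 ≤ c ^ 2 := by
    rcases le_total 0 (r ^ 2 - (t / 2) ^ 2) with h | h
    · rw [hc, Real.sq_sqrt h]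
    · exact h.trans (sq_nonneg _)
  obtain ⟨ε, hε0, hε⟩ := exists_between (show 0 < min ((r - c) / (q + 3)) (a / (4 * D * (q + 1))) from
    lt_min (div_pos (by linarith) (by positivity)) (by positivity))
  obtain ⟨hε1, hε2⟩ := lt_min_iff.1 hε
  rw [lt_div_iff₀ (by positivity)] at hε1 hε2
  refine ⟨c + 2 * ε, ε, hε0, by linarith, by nlinarith, by linarith, ?_⟩
  have : 0 < ε * (4 * D) := by positivity
  linarith

/-- A column of sites with a row of sites above it, with their stable radii. -/
theorem exists_column_row {h q : ℕ} (hh : 0 < h) (hq : 100000 * h ≤ q) {a : ℝ} (ha : 0 < a) :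
    ∃ (s : ColumnIndex (100 * h) (5 * h) ⊕ Fin q → Plane)
      (ρ : ColumnIndex (100 * h) (5 * h) ⊕ Fin q → ℝ),
      Function.Injective s ∧ (∀ o, volume (cellCore s ρ o) = ENNReal.ofReal a) ∧
      ∃ (A P : ℕ → ColumnIndex (100 * h) (5 * h) ⊕ Fin q) (x ε y t r Y : ℝ),
        ∀ i ≤ 33000 * h, ∀ j < 20 * h,
          IsNotch s ρ (A i) (P j) (P (j + 1)) (x + i * ε) ε (y + j * t) t r Y := by
  have h1 : (1 : ℝ) ≤ h := by exact_mod_cast hh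
  have hha : 0 < h * a := by positivity
  set r := Real.sqrt (h * a) with hr_def
  have hr : 0 < r := Real.sqrt_pos.2 hha
  have hra : r ^ 2 = h * a := Real.sq_sqrt hha.le
  obtain ⟨t, e, ρ₁, ht, he, htl, htu, hη, ha₁, hρ₁, hR⟩ := exists_column hh ha hr hra
  obtain ⟨x, ε, hε, hpos, hgap, hlt, harea⟩ :=
    exists_spacing (D := 100 * r) q hr ht ha (by positivity)
  have hL : ((100 * h : ℕ) : ℝ) * t ≤ 67 * r := by push_cast; linarith
  -- Column sites have height at most `Y - 19 * r` and radius at most `7 * r`, so they are preferred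
  -- wherever they reach; yet radius `100 * r` still takes the row past the bottom of the
  -- progression.
  set Y := ((100 * h : ℕ) : ℝ) * t + 20 * r with hY
  have hm0 : 0 ≤ ((100 * h : ℕ) : ℝ) * t := by positivity
  have hsep : ∀ i p, dist p (columnSite (100 * h) (5 * h) t e i) ≤ ρ₁ i →
      ∀ k, dist p (columnSite (100 * h) (5 * h) t e i) < dist p (rowSite q x ε Y k) := by
    intro i p hp k
    have h2 := (columnHeight_mem (m := 100 * h) (K := 5 * h) ht he i).2
    have h3 := Plane.abs_le_dist (columnSite (100 * h) (5 * h) t e i) (rowSite q x ε Y k)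
    rw [columnSite_one, rowSite_one] at h3
    have h4 := (neg_le_abs _).trans h3
    have h5 := dist_triangle_left (columnSite (100 * h) (5 * h) t e i) (rowSite q x ε Y k) p
    linarith [hR i]
  obtain ⟨μ, ρ₂, hμ, ha₂, hvol⟩ := exists_radii_glue (injective_rowSite hε) ha₁ hsep
  have hx0 : ∀ i : ℕ, x - ε ≤ x + i * ε - ε := fun i => by
    have : 0 ≤ (i : ℝ) * ε := by positivity
    linarith
  have hxq : ∀ i : ℕ, i < q → x + i * ε + ε < r := fun i hi => by
    have : (i : ℝ) * ε ≤ q * ε := by gcongr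
    linarith
  -- The margin `33000 * h` on either side comes from `3.15 * 101² < 33000` and `r ^ 2 = h * a`.
  have hρ₂ : ∀ i : Fin q, 33000 * h ≤ (i : ℕ) → (i : ℕ) + 33000 * h < q → 100 * r ≤ ρ₂ i := by
    intro i hi1 hi2
    refine le_radius_of_row hμ ha₂ ha hε (by positivity) harea ?_ hi1 hi2
    have h2 : (100 * r + q * ε) ^ 2 ≤ (101 * r) ^ 2 := by
      gcongr; linarith
    have h3 : Real.pi * (100 * r + q * ε) ^ 2 ≤ 3.15 * (101 * r) ^ 2 := by
      gcongr; exact Real.pi_lt_d2.le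
    push_cast
    nlinarith
  have hD : ∀ p : Plane, 0 ≤ p 0 → p 0 ≤ r → 0 ≤ p 1 → p 1 ≤ (100 * h : ℕ) * t →
      ∀ i, dist p (rowSite q x ε Y i) < 100 * r := by
    intro p hp1 hp2 hp3 hp4 i
    rw [Plane.dist_lt_iff (by positivity), rowSite_zero, rowSite_one]
    have h2 := hx0 i
    have h3 := hxq i i.2
    have h4 : (p 0 - (x + (i : ℕ) * ε)) ^ 2 ≤ (2 * r) ^ 2 :=
      sq_le_sq' (by linarith) (by linarith)
    have h5 : (p 1 - Y) ^ 2 ≤ (87 * r) ^ 2 := sq_le_sq' (by linarith) (by linarith)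
    nlinarith
  -- The minima only make the index maps total. The row starts at index `33000 * h + 1` so that the
  -- left neighbor is a middle site too; the notches from `40 * h` on keep a height of at least `20
  -- * r` from either end of the progression, beyond the radii there.
  refine ⟨Sum.elim (columnSite _ _ t e) (rowSite q x ε Y), Sum.elim ρ₁ ρ₂, ?_, hvol,
    fun i => .inr ⟨min (33000 * h + 1 + i) (q - 1), by omega⟩,
    fun j => .inl (.inl ⟨min (40 * h + j) (100 * h), by omega⟩),
    x + (33000 * h + 1 : ℕ) * ε, ε, (40 * h : ℕ) * t, t, r, Y, ?_⟩
  · refine (injective_columnSite ht he).sumElim (injective_rowSite hε) fun i k heq => ?_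
    have h2 := (columnHeight_mem (m := 100 * h) (K := 5 * h) ht he i).2
    have h3 : columnHeight (100 * h) (5 * h) t e i = Y := congrArg (fun p : Plane => p 1) heq
    linarith
  · intro i hi j hj
    have hiq : 33000 * h + 1 + i + 1 + 33000 * h < q := by omega
    have ei : min (33000 * h + 1 + i) (q - 1) = 33000 * h + 1 + i := by omega
    have ej : min (40 * h + j) (100 * h) = 40 * h + j := by omega
    have ej' : min (40 * h + (j + 1)) (100 * h) = 40 * h + j + 1 := by omega
    simp only [ei, ej, ej']
    have e1 : x + ((33000 * h + 1 : ℕ) : ℝ) * ε + i * ε =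
        x + (((33000 * h + 1 + i : ℕ)) : ℝ) * ε := by push_cast; ring
    have e2 : ((40 * h : ℕ) : ℝ) * t + j * t = ((40 * h + j : ℕ) : ℝ) * t := by push_cast; ring
    rw [e1, e2]
    have hx0' := hx0 (33000 * h + 1 + i)
    have hj1 : (j : ℝ) + 1 ≤ 20 * h := by exact_mod_cast hj
    have hj2 : ((j : ℝ) + 1) * t ≤ 20 * h * t := by gcongr
    have hj3 : 0 ≤ (j : ℝ) * t := by positivity
    exact isNotch_column_row (R := 7 * r) (D := 100 * r)
      (i := ⟨33000 * h + 1 + i, by omega⟩) (i₁ := ⟨33000 * h + i, by omega⟩)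
      (i₂ := ⟨33000 * h + 1 + i + 1, by omega⟩) (k := ⟨40 * h + j, by omega⟩)
      (l := ⟨40 * h + j + 1, by omega⟩) ht he hr hε hsep hρ₁ (by positivity) hR hD
      (by simp only; omega) rfl
      (hρ₂ _ (by simp only; omega) (by simp only; omega))
      (hρ₂ _ (by simp only; omega) (by simp only; omega))
      (hρ₂ _ (by simp only; omega) (by simp only; omega))
      (by linarith) (hxq _ (by omega)) (by nlinarith) rfl (by push_cast; linarith)
      (by push_cast; linarith)

/-! ### Relabeling the sites and the final count -/

theorem ofReal_le_encard {α : Type*} {S : Set α} {k : ℕ} (h : (k : ℕ∞) ≤ S.encard) {x : ℝ}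
    (hx : x ≤ k) : ENNReal.ofReal x ≤ (S.encard : ℝ≥0∞) := by
  calc ENNReal.ofReal x ≤ ENNReal.ofReal (k : ℝ) := ENNReal.ofReal_le_ofReal hx
    _ = ((k : ℕ∞) : ℝ≥0∞) := by rw [ENNReal.ofReal_natCast]; rfl
    _ ≤ _ := by exact_mod_cast h

theorem cellCore_comp_equiv {ι κ : Type*} (f : κ ≃ ι) (s : ι → Plane) (ρ : ι → ℝ) (i : κ) :
    cellCore (s ∘ f) (ρ ∘ f) i = cellCore s ρ (f i) := by
  ext p
  simp only [cellCore, mem_ofPred_eq, Function.comp_apply, f.surjective.forall,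
    ne_eq, f.injective.eq_iff]

theorem IsNotch.comp_equiv {ι κ : Type*} (f : κ ≃ ι) {s : ι → Plane} {ρ : ι → ℝ} {A P Q : ι}
    {x ε y t r Y : ℝ} (h : IsNotch s ρ A P Q x ε y t r Y) :
    IsNotch (s ∘ f) (ρ ∘ f) (f.symm A) (f.symm P) (f.symm Q) x ε y t r Y := by
  obtain ⟨B, hB⟩ := h.left
  obtain ⟨B', hB'⟩ := h.right
  have e : ∀ i, (s ∘ f) (f.symm i) = s i := fun i => by simp
  have e' : ∀ i, (ρ ∘ f) (f.symm i) = ρ i := fun i => by simp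
  exact
    { ε_pos := h.ε_pos
      t_pos := h.t_pos
      r_pos := h.r_pos
      A_zero := by rw [e]; exact h.A_zero
      A_one := by rw [e]; exact h.A_one
      P_zero := by rw [e]; exact h.P_zero
      P_one := by rw [e]; exact h.P_one
      Q_zero := by rw [e]; exact h.Q_zero
      Q_one := by rw [e]; exact h.Q_one
      radius_P := by rw [e']; exact h.radius_P
      radius_Q := by rw [e']; exact h.radius_Q
      pos := h.pos
      lt := h.lt
      gap := h.gap
      reach := by rw [e, e']; exact h.reach
      left := ⟨f.symm B, by rw [e, e']; exact hB⟩
      right := ⟨f.symm B', by rw [e, e']; exact hB'⟩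
      others := fun k hA hP hQ => h.others (f k) (fun h => hA (by simp [← h]))
        (fun h => hP (by simp [← h])) (fun h => hQ (by simp [← h]))
      prefer_P := by rw [e, e]; exact h.prefer_P
      prefer_Q := by rw [e, e]; exact h.prefer_Q
      strip := by rw [e, cellCore_comp_equiv, f.apply_symm_apply]; exact h.strip }

theorem mainTheorem2 :
    ∃ c : ℝ, 0 < c ∧ ∃ N : ℕ, ∀ n : ℕ, N ≤ n → ∀ a : ℝ, 0 < a →
      ∃ (s : Fin n → Plane) (C : Option (Fin n) → Set Plane),
        Function.Injective s ∧
        IsStableMatchingVoronoi s (fun _ => a) C ∧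
        ENNReal.ofReal (c * (n : ℝ) ^ 2) ≤ ((cellFaces C).encard : ℝ≥0∞) ∧
        ENNReal.ofReal (c * (n : ℝ) ^ 2) ≤ ((edges C).encard : ℝ≥0∞) ∧
        ENNReal.ofReal (c * (n : ℝ) ^ 2) ≤ ((vertices C).encard : ℝ≥0∞) := by
  -- With `h = n / 200000` rounded down, `n ≤ 400000 * h`, so `n² / 10⁶ ≤ 160000 * h²`, below the
  -- `660000 * h²` notches counted. All sites not in the column go into the row.
  refine ⟨1 / 10 ^ 6, by norm_num, 200000, fun n hn a ha => ?_⟩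
  obtain ⟨h, hh⟩ : ∃ h, h = n / 200000 := ⟨_, rfl⟩
  have hh0 : 0 < h := by omega
  obtain ⟨q, hq⟩ : ∃ q, n = 100 * h + 1 + (5 * h + 5 * h) + q :=
    ⟨n - (100 * h + 1 + (5 * h + 5 * h)), by omega⟩
  obtain ⟨s, ρ, hs, hvol, A, P, x, ε, y, t, r, Y, hN⟩ :=
    exists_column_row (q := q) hh0 (by omega) ha
  have f : Fin n ≃ ColumnIndex (100 * h) (5 * h) ⊕ Fin q :=
    Fintype.equivOfCardEq (by simp [hq])
  have hN' : ∀ i ≤ 33000 * h, ∀ j < 20 * h, IsNotch (s ∘ f) (ρ ∘ f) ((f.symm ∘ A) i)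
      ((f.symm ∘ P) j) ((f.symm ∘ P) (j + 1)) (x + i * ε) ε (y + j * t) t r Y :=
    fun i hi j hj => (hN i hi j hj).comp_equiv f
  have hle : 1 / 10 ^ 6 * (n : ℝ) ^ 2 ≤ ((33000 * h * (20 * h) : ℕ) : ℝ) := by
    have h1 : (n : ℝ) ≤ 400000 * h := by
      have : n ≤ 400000 * h := by omega
      exact_mod_cast this
    have h2 : (n : ℝ) ^ 2 ≤ (400000 * h) ^ 2 := by gcongr
    push_cast
    nlinarith
  refine ⟨s ∘ f, radiiDiagram (s ∘ f) (ρ ∘ f), hs.comp f.injective,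
    isStableMatchingVoronoi_radiiDiagram (hs.comp f.injective) fun i => ?_,
    ofReal_le_encard (mul_le_encard_cellFaces hN') hle,
    ofReal_le_encard (mul_le_encard_edges hN') hle,
    ofReal_le_encard (mul_le_encard_vertices hN') hle⟩
  rw [cellCore_comp_equiv, hvol]
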